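/- Let $n\ge 2$, $\alpha>0$ and, for $a>0$, let $\mathbf L^2=L^2((0,a)\times\mathbb S^{n-2},\,x\,dx\,d\theta)$ (real-valued functions), where $\mathbb S^{n-2}\subset\mathbb R^{n-1}$ is the unit sphere and $d\theta$ its standard measure. Put $$\mathbf D_xv=\partial_xv+\frac{\alpha}{x}v,\qquad \mathbf D_x^*v=-\partial_xv+\frac{\alpha-1}{x}v ,$$ and let $\mathbf D_x^{(k)}$ be $(\mathbf D_x^*\mathbf D_x)^{k/2}$ for even $k$ and $\mathbf D_x(\mathbf D_x^*\mathbf D_x)^{(k-1)/2}$ for odd $k$. With $\xi=x/a$, the corresponding operators in the variable $\xi$ are $\mathbf D_\xi^{(k)}=a^k\mathbf D_x^{(k)}$, and $\mathbf D_\xi=\mathbf D_\xi^{(1)}$. All derivatives are weak derivatives, tested against $C^\infty_c((0,a)\times\mathbb S^{n-2})$. The angular derivatives $D_\theta$ are those along the rotation fields $Y_{ij}=\theta_i\partial_{\theta_j}-\theta_j\partial_{\theta_i}$, $1\le i<j\le n-1$, and $$\|D_\theta^lv\|_{\mathbf L^2}^2=\sum\|Y_{i_1j_1}\cdots Y_{i_lj_l}v\|_{\mathbf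 L^2}^2,$$ the sum being over all $i_r<j_r$, $r=1,\dots,l$. Let $\mathbf H^0=\mathbf L^2$ and $$\mathbf H^{k+1}=\{v\in\mathbf H^k:\ D_\theta v\in\mathbf H^k,\ \mathbf D_x^{(k+1)}v\in\mathbf L^2\},\qquad k\ge0,$$ and let $\mathbf H^1_0$ be the closure of $C^\infty_c((0,a)\times\mathbb S^{n-2})$ in $\mathbf H^1$ with respect to the norm $\|v\|_{\mathbf L^2}+\|\mathbf D_xv\|_{\mathbf L^2}+\|D_\theta v\|_{\mathbf L^2}$. For $b>0$ define the norms $\|v\|_{\mathbf H^0_b}=\|v\|_{\mathbf L^2}$ and, for $m\ge1$, $$\|v\|_{\mathbf H^m_b}=\frac{\|v\|_{\mathbf L^2}}{b}+\sum_{l=1}^m\Big(\|D_\theta^lv\|_{\mathbf L^2}+\frac{\|D_\theta^{l-1}\mathbf D_\xi v\|_{\mathbf L^2}}{b}\Big)+\sum_{l=0}^{m-2}\frac{\|D_\theta^l\mathbf D_\xi^{(m-l)}v\|_{\mathbf L^2}}{b^2},$$ where the last sum is empty for $m=1$. Let $m\ge0$ be an integer and let $a_0>0$. Then there is a constant $c_m>0$,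 depending only on $m,n,\alpha,a_0$, such that the following holds for every $a\in(0,a_0]$. Let $F\in\mathbf H^m$ and let $w\in\mathbf H^1_0$ be a weak solution of $\mathbf D_x^*\mathbf D_xw-\Delta_\theta w=F$ on $(0,a)\times\mathbb S^{n-2}$, that is, $$\int\big(\mathbf D_xw\,\mathbf D_xv+\nabla_\theta w\cdot\nabla_\theta v\big)\,x\,dx\,d\theta=\int Fv\,x\,dx\,d\theta\qquad\text{for all }v\in\mathbf H^1_0,$$ where $\nabla_\theta$ is the covariant gradient on the sphere. Then $w\in\mathbf H^{m+2}$ and $$\|w\|_{\mathbf H^{m+2}_a}\le c_m\,\|F\|_{\mathbf H^m_1}.$$ -/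

import Mathlib

open MeasureTheory
open scoped ContDiff

noncomputable section

namespace TwistedSobolev

/-- Euclidean space `ℝ^{n-1}`, in which the unit sphere `S^{n-2}` lives. -/
abbrev E (n : ℕ) : Type := EuclideanSpace ℝ (Fin (n - 1))

/-- The unit sphere `S^{n-2}`. -/
abbrev S (n : ℕ) : Type := Metric.sphere (0 : E n) 1

/-- The measure `x dx dθ` on `(0,a) × S^{n-2}`, where `dθ` is the standard surface measure. -/
def wMeasure (n : ℕ) (a : ℝ) : Measure (ℝ × S n) :=
  ((volume.restrict (Set.Ioo 0 a)).withDensity fun x => ENNReal.ofReal x).prod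
    (volume : Measure (E n)).toSphere

/-- The space `L² = L²((0,a) × S^{n-2}, x dx dθ)` of real-valued functions. -/
abbrev L2 (n : ℕ) (a : ℝ) : Type := Lp ℝ 2 (wMeasure n a)

/-- The inclusion of `ℝ × S^{n-2}` in `ℝ × ℝ^{n-1}`. -/
def emb {n : ℕ} (p : ℝ × S n) : ℝ × E n := (p.1, (p.2 : E n))

/-- Test functions. The functions in `C_c^∞((0,a) × S^{n-2})` are exactly the restrictions `φ ∘ emb`
of the smooth functions `φ` on `ℝ × ℝ^{n-1}` whose support is a compact subset of
`(0,a) × ℝ^{n-1}`. -/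
structure IsTest (n : ℕ) (a : ℝ) (φ : ℝ × E n → ℝ) : Prop where
  smooth : ContDiff ℝ ∞ φ
  compact : HasCompactSupport φ
  support : tsupport φ ⊆ Set.Ioo 0 a ×ˢ Set.univ

/-! ### Classical derivatives of test functions -/

/-- `∂_x φ`. -/
def dx {n : ℕ} (φ : ℝ × E n → ℝ) (q : ℝ × E n) : ℝ := fderiv ℝ φ q (1, 0)

/-- `D_x φ = ∂_x φ + (α / x) φ`. -/
def cD {n : ℕ} (α : ℝ) (φ : ℝ × E n → ℝ) (q : ℝ × E n) : ℝ := dx φ q + α / q.1 * φ q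

/-- `D_x^* φ = -∂_x φ + ((α - 1) / x) φ`. -/
def cDstar {n : ℕ} (α : ℝ) (φ : ℝ × E n → ℝ) (q : ℝ × E n) : ℝ :=
  -dx φ q + (α - 1) / q.1 * φ q

/-- The rotation vector field `θ_i ∂_j - θ_j ∂_i`. It is tangent to the sphere, and the fields with
`i < j` span the tangent space of the sphere at each point. -/
def rotField {n : ℕ} (i j : Fin (n - 1)) (θ : E n) : E n :=
  θ i • EuclideanSpace.single j (1 : ℝ) - θ j • EuclideanSpace.single i (1 : ℝ)

/-- The angular derivative `Y_{ij} φ = (θ_i ∂_j - θ_j ∂_i) φ`. -/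
def cY {n : ℕ} (i j : Fin (n - 1)) (φ : ℝ × E n → ℝ) (q : ℝ × E n) : ℝ :=
  fderiv ℝ φ q (0, rotField i j q.2)

/-! ### Weak derivatives in `L²` -/

variable {n : ℕ} {a : ℝ}

/-- `g = D_x v` in the weak sense. -/
def HasD (α : ℝ) (v g : L2 n a) : Prop :=
  ∀ φ, IsTest n a φ →
    ∫ p, v p * cDstar α φ (emb p) ∂(wMeasure n a) = ∫ p, g p * φ (emb p) ∂(wMeasure n a)

/-- `g = D_x^* v` in the weak sense. -/
def HasDstar (α : ℝ) (v g : L2 n a) : Prop :=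
  ∀ φ, IsTest n a φ →
    ∫ p, v p * cD α φ (emb p) ∂(wMeasure n a) = ∫ p, g p * φ (emb p) ∂(wMeasure n a)

/-- `g = Y_{ij} v` in the weak sense (`Y_{ij}` is formally skew-adjoint). -/
def HasY (i j : Fin (n - 1)) (v g : L2 n a) : Prop :=
  ∀ φ, IsTest n a φ →
    ∫ p, v p * cY i j φ (emb p) ∂(wMeasure n a) = -∫ p, g p * φ (emb p) ∂(wMeasure n a)

/-- `g = D_x^{(k)} v` in the weak sense, where `D_x^{(k)}` is the product of `k` factors that are
alternately `D_x` and `D_x^*`, the first one applied being `D_x`. -/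
def HasDord (α : ℝ) : ℕ → L2 n a → L2 n a → Prop
  | 0, v, g => g = v
  | k + 1, v, g => ∃ h, HasDord α k v h ∧ if Even k then HasD α h g else HasDstar α h g

open Classical in
/-- `D_x^{(k)} v`, with the value zero if it does not exist in `L²`. -/
def Dord (α : ℝ) (k : ℕ) (v : L2 n a) : L2 n a :=
  if h : ∃ g, HasDord α k v g then h.choose else 0

open Classical in
/-- `Y_{ij} v`, with the value zero if it does not exist in `L²`. -/
def Y (i j : Fin (n - 1)) (v : L2 n a) : L2 n a :=
  if h : ∃ g, HasY i j v g then h.choose else 0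

/-- The covariant gradient on the sphere, as a tangent vector in `ℝ^{n-1}`: its `k`-th component
is `∑_j θ_j Y_{jk} v = ∂_k v - θ_k ∑_j θ_j ∂_j v`. -/
def angGrad (v : L2 n a) (p : ℝ × S n) : E n :=
  WithLp.toLp 2 fun k => ∑ j, (p.2 : E n) j * Y j k v p

/-! ### Twisted Sobolev spaces -/

/-- The twisted Sobolev space `H^k`:
`v ∈ H^{k+1}` if and only if `v ∈ H^k`, `D_θ v ∈ H^k` and `D_x^{(k+1)} v ∈ L²`. -/
def MemH (α : ℝ) : ℕ → L2 n a → Prop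
  | 0, _ => True
  | k + 1, v => MemH α k v ∧ (∀ i j, ∃ g, HasY i j v g ∧ MemH α k g) ∧ ∃ g, HasDord α (k + 1) v g

/-- `‖D_θ^l v‖²`: the sum of `‖Y_{i_1 j_1} ⋯ Y_{i_l j_l} v‖²` over all choices of indices
`i_r < j_r`. -/
def angNormSq : ℕ → L2 n a → ℝ
  | 0, v => ‖v‖ ^ 2
  | l + 1, v => ∑ p : {p : Fin (n - 1) × Fin (n - 1) // p.1 < p.2},
      angNormSq l (Y p.1.1 p.1.2 v)

/-- `‖D_θ^l v‖`. -/
def angNorm (l : ℕ) (v : L2 n a) : ℝ := Real.sqrt (angNormSq l v)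

/-- The norm of `H^1`. -/
def h1Norm (α : ℝ) (v : L2 n a) : ℝ := ‖v‖ + ‖Dord α 1 v‖ + angNorm 1 v

/-- The space `H^1_0`: the closure of `C_c^∞((0,a) × S^{n-2})` in `H^1`. -/
def MemH10 (α : ℝ) (v : L2 n a) : Prop :=
  MemH α 1 v ∧ ∀ ε > 0, ∃ φ, IsTest n a φ ∧
    ∃ u : L2 n a, (u =ᵐ[wMeasure n a] fun p => φ (emb p)) ∧ h1Norm α (v - u) < ε

/-- `w ∈ H^1_0` is a weak solution of `D_x^* D_x w - Δ_θ w = F` in `(0,a) × S^{n-2}`. -/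
def IsWeakSolution (α : ℝ) (w F : L2 n a) : Prop :=
  MemH10 α w ∧ ∀ v : L2 n a, MemH10 α v →
    ∫ p, (Dord α 1 w p * Dord α 1 v p + inner ℝ (angGrad w p) (angGrad v p)) ∂(wMeasure n a) =
      ∫ p, F p * v p ∂(wMeasure n a)

/-- `D_ξ^{(k)} v`, the ordered twisted derivative with respect to the variable `ξ = x / a`:
since `D_ξ = a D_x` and `D_ξ^* = a D_x^*`, it is `a ^ k D_x^{(k)} v`. -/
def DordXi (α : ℝ) (k : ℕ) (v : L2 n a) : L2 n a := a ^ k • Dord α k v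

/-- The norm `‖v‖_{H^m_b}` of a function on `(0,a) × S^{n-2}`; the derivatives are those with
respect to `ξ = x / a`, and `b` is the parameter in the prefactors. The last sum runs over
`0 ≤ l ≤ m - 2`. -/
def hNorm (α b : ℝ) : ℕ → L2 n a → ℝ
  | 0, v => ‖v‖
  | m + 1, v => ‖v‖ / b
      + ∑ l ∈ Finset.Icc 1 (m + 1), (angNorm l v + angNorm (l - 1) (DordXi α 1 v) / b)
      + ∑ l ∈ Finset.range m, angNorm l (DordXi α (m + 1 - l) v) / b ^ 2

end TwistedSobolev

end

open TwistedSobolev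

open MeasureTheory
open scoped ContDiff

noncomputable section

namespace TwistedSobolev

/-! ### Test functions -/

section Test

variable {n : ℕ} {a : ℝ} {φ ψ : ℝ × E n → ℝ}

/-! The proof is the energy method, with rotation symmetry in place of difference quotients. The
expansion `|D_x φ|² = (∂_x φ)² + (α/x)² φ² + α D_1(φ²/x)`, where `D_1` is `D_x` with `α = 1`, whose
integral against `x dx dθ` vanishes on test functions, gives the Hardy inequality `‖φ‖ ≤ (a/α) ‖D_x
φ‖` (`hardy`). The energy form is therefore coercive on the completion of the test functions, and
Lax–Milgram yields a solution operator `sol`. Since that completion is `H^1_0` (`exists_val_eq`,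
`memH10_val`) and the covariant gradients pair like the sum over the rotation fields
(`inner_angGrad`), every weak solution is `val (sol F)`.

Angular regularity comes from two properties of `S = val ∘ sol`: it is symmetric, and it commutes
with rotations. Hence `(S F, R_t G) = (S G, R_{-t} F)` for the rotations `R_t` of a coordinate
plane; the derivative at `t = 0` is `(Y S F, G) = -(F, Y S G)`. By duality `Y S F` is the
Lax–Milgram solution with the distribution `Y F` as right-hand side (`val_solY`). So `Y S F` lies in
the energy space, with energy at most `‖F‖²`, and `Y S F = S Y F` when `Y F` is in `L²`. Angular
derivatives of any order thus pass to `F`.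

Radial regularity is read off the equation: `D^{(j+2)} w = D^{(j)} F + ∑ Y² D^{(j)} w` trades two
radial derivatives for two angular ones (`Dord_sol`). The total order is preserved, so only
top-order terms of `F` occur. The weights follow by scaling: the energy estimates give a factor
`a/α` for each order below two, and each pair of `D_ξ` carries a factor `a²`, which cancels the
weight `a⁻²` or is bounded by `a₀²`. -/

lemma IsTest.of_eq_zero (h : IsTest n a φ) (hψ : ContDiff ℝ ∞ ψ)
    (hz : ∀ q, q ∉ tsupport φ → ψ q = 0) : IsTest n a ψ := by
  have hs : tsupport ψ ⊆ tsupport φ := closure_minimal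
    (fun q hq => by by_contra hq'; exact hq (hz q hq')) (isClosed_tsupport φ)
  exact ⟨hψ, h.compact.of_isClosed_subset (isClosed_tsupport ψ) hs, hs.trans h.support⟩

lemma IsTest.zero : IsTest n a (0 : ℝ × E n → ℝ) :=
  ⟨contDiff_const, HasCompactSupport.zero, by simp [tsupport]⟩

lemma IsTest.eq_zero (h : IsTest n a φ) {q : ℝ × E n} (hq : q.1 ∉ Set.Ioo 0 a) : φ q = 0 :=
  image_eq_zero_of_notMem_tsupport fun hq' => hq (h.support hq').1

lemma IsTest.add (h : IsTest n a φ) (h' : IsTest n a ψ) : IsTest n a (φ + ψ) := by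
  refine ⟨h.smooth.add h'.smooth, h.compact.add h'.compact, ?_⟩
  exact (tsupport_add φ ψ).trans (Set.union_subset h.support h'.support)

lemma IsTest.mul_left {f : ℝ × E n → ℝ} (hf : ContDiff ℝ ∞ f) (h : IsTest n a φ) :
    IsTest n a (fun q => f q * φ q) :=
  h.of_eq_zero (hf.mul h.smooth) fun q hq => by
    rw [image_eq_zero_of_notMem_tsupport hq, mul_zero]

lemma IsTest.smul (c : ℝ) (h : IsTest n a φ) : IsTest n a (c • φ) :=
  h.mul_left (f := fun _ => c) contDiff_const

/-- The support stays away from `x = 0`, so the singular coefficient does no harm. This is why `D_x`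
and `D_x^*` map test functions to test functions. -/
lemma IsTest.div_fst (h : IsTest n a φ) : IsTest n a (fun q => φ q / q.1) := by
  refine h.of_eq_zero (contDiff_iff_contDiffAt.2 fun q => ?_) fun q hq => by
    rw [image_eq_zero_of_notMem_tsupport hq, zero_div]
  by_cases hq : q ∈ tsupport φ
  · exact h.smooth.contDiffAt.div contDiffAt_fst (h.support hq).1.1.ne'
  · have : (fun q => φ q / q.1) =ᶠ[nhds q] fun _ => 0 := by
      filter_upwards [(isClosed_tsupport φ).isOpen_compl.mem_nhds hq] with r hr
      rw [image_eq_zero_of_notMem_tsupport hr, zero_div]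
    exact contDiffAt_const.congr_of_eventuallyEq this

lemma fderiv_eq_zero_of_notMem {q : ℝ × E n} (hq : q ∉ tsupport φ) : fderiv ℝ φ q = 0 := by
  by_contra h
  exact hq (support_fderiv_subset ℝ h)

lemma contDiff_rotField (i j : Fin (n - 1)) : ContDiff ℝ ∞ (rotField (n := n) i j) := by
  have hc : ∀ k : Fin (n - 1), ContDiff ℝ ∞ (fun θ : E n => θ k) := fun k =>
    (EuclideanSpace.proj (𝕜 := ℝ) k : E n →L[ℝ] ℝ).contDiff
  exact ((hc i).smul contDiff_const).sub ((hc j).smul contDiff_const)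

lemma IsTest.fderiv_apply (h : IsTest n a φ) {X : ℝ × E n → ℝ × E n} (hX : ContDiff ℝ ∞ X) :
    IsTest n a (fun q => fderiv ℝ φ q (X q)) :=
  h.of_eq_zero ((h.smooth.fderiv_right (m := ∞) (by simp)).clm_apply hX) fun q hq => by
    rw [fderiv_eq_zero_of_notMem hq]; rfl

lemma IsTest.dx (h : IsTest n a φ) : IsTest n a (dx φ) := h.fderiv_apply contDiff_const

lemma IsTest.cY (i j : Fin (n - 1)) (h : IsTest n a φ) : IsTest n a (cY i j φ) :=
  h.fderiv_apply (contDiff_const.prodMk ((contDiff_rotField i j).comp contDiff_snd))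

lemma IsTest.cD (α : ℝ) (h : IsTest n a φ) : IsTest n a (cD α φ) := by
  convert h.dx.add (h.div_fst.smul α) using 1
  ext q
  simp [TwistedSobolev.cD]
  ring

lemma IsTest.cDstar (α : ℝ) (h : IsTest n a φ) : IsTest n a (cDstar α φ) := by
  convert (h.dx.smul (-1)).add (h.div_fst.smul (α - 1)) using 1
  ext q
  simp [TwistedSobolev.cDstar]
  ring

/-- The action of a linear isometry on the angular variable. -/
def rotate (R : E n ≃ₗᵢ[ℝ] E n) (φ : ℝ × E n → ℝ) (q : ℝ × E n) : ℝ := φ (q.1, R q.2)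

lemma IsTest.rotate (R : E n ≃ₗᵢ[ℝ] E n) (h : IsTest n a φ) : IsTest n a (rotate R φ) := by
  let e : ℝ × E n ≃ₜ ℝ × E n := (Homeomorph.refl ℝ).prodCongr R.toHomeomorph
  have he : TwistedSobolev.rotate R φ = φ ∘ e := rfl
  refine ⟨?_, ?_, ?_⟩
  · exact h.smooth.comp (contDiff_fst.prodMk (R.contDiff.comp contDiff_snd))
  · rw [he]; exact h.compact.comp_homeomorph e
  · rw [he, tsupport_comp_eq_preimage]
    intro q hq
    exact ⟨(h.support hq).1, trivial⟩

lemma IsTest.exists_bound (h : IsTest n a φ) : ∃ C : ℝ, ∀ q, ‖φ q‖ ≤ C :=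
  h.compact.exists_bound_of_continuous h.smooth.continuous

end Test

/-! ### The measure -/

section Measure

variable {n : ℕ} {a : ℝ} {φ ψ : ℝ × E n → ℝ}

instance isFiniteMeasure_radial (a : ℝ) : IsFiniteMeasure
    ((volume.restrict (Set.Ioo 0 a)).withDensity fun x => ENNReal.ofReal x) := by
  refine isFiniteMeasure_withDensity_ofReal ?_
  exact (continuous_id.integrableOn_Icc (a := 0) (b := a)).mono_set Set.Ioo_subset_Icc_self |>.2

instance isFiniteMeasure_wMeasure (n : ℕ) (a : ℝ) : IsFiniteMeasure (wMeasure n a) := by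
  unfold wMeasure; infer_instance

lemma continuous_emb : Continuous (emb (n := n)) :=
  continuous_fst.prodMk (continuous_subtype_val.comp continuous_snd)

lemma measurableEmbedding_emb : MeasurableEmbedding (emb (n := n)) := by
  have h : Topology.IsClosedEmbedding (emb (n := n)) :=
    Topology.IsClosedEmbedding.id.prodMap Metric.isClosed_sphere.isClosedEmbedding_subtypeVal
  exact h.measurableEmbedding

lemma ae_mem_Ioo (n : ℕ) (a : ℝ) : ∀ᵐ p ∂(wMeasure n a), p.1 ∈ Set.Ioo 0 a := by
  have h : ∀ᵐ x ∂((volume.restrict (Set.Ioo 0 a)).withDensity fun x => ENNReal.ofReal x),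
      x ∈ Set.Ioo 0 a :=
    (withDensity_absolutelyContinuous _ _).ae_le (ae_restrict_mem measurableSet_Ioo)
  exact Measure.quasiMeasurePreserving_fst.ae h

lemma IsTest.memLp (h : IsTest n a φ) (p : ENNReal) :
    MemLp (fun x => φ (emb x)) p (wMeasure n a) := by
  obtain ⟨C, hC⟩ := h.exists_bound
  exact MemLp.of_bound (h.smooth.continuous.comp continuous_emb).aestronglyMeasurable C
    (Filter.Eventually.of_forall fun x => hC _)

lemma IsTest.integrable (h : IsTest n a φ) :
    Integrable (fun x => φ (emb x)) (wMeasure n a) :=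
  memLp_one_iff_integrable.1 (h.memLp 1)

lemma IsTest.integrable_mul (h : IsTest n a φ) {g : ℝ × S n → ℝ}
    (hg : Integrable g (wMeasure n a)) : Integrable (fun x => g x * φ (emb x)) (wMeasure n a) := by
  obtain ⟨C, hC⟩ := h.exists_bound
  exact hg.mul_bdd (h.smooth.continuous.comp continuous_emb).aestronglyMeasurable
    (Filter.Eventually.of_forall fun x => hC _)

lemma integrable_L2 (v : L2 n a) : Integrable v (wMeasure n a) :=
  memLp_one_iff_integrable.1 ((Lp.memLp v).mono_exponent (by norm_num))

lemma integrable_L2_mul (v w : L2 n a) : Integrable (fun p => v p * w p) (wMeasure n a) :=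
  (Lp.memLp v).integrable_mul (Lp.memLp w)

/-- Integrable functions that annihilate all test functions vanish. -/
lemma ae_eq_zero_of_integral_test {g : ℝ × S n → ℝ} (hg : Integrable g (wMeasure n a))
    (h : ∀ φ, IsTest n a φ → ∫ p, g p * φ (emb p) ∂(wMeasure n a) = 0) :
    g =ᵐ[wMeasure n a] 0 := by
  -- The measure is pushed forward to the ambient space, where the fundamental lemma of the calculus
  -- of variations applies on an open set.
  have he := measurableEmbedding_emb (n := n)
  let μ' := (wMeasure n a).map emb
  let g' : ℝ × E n → ℝ := Function.extend emb g 0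
  have hg'e : ∀ p, g' (emb p) = g p := fun p => he.injective.extend_apply g 0 p
  have hg' : Integrable g' μ' := by
    rw [he.integrable_map_iff]
    exact hg.congr (Filter.Eventually.of_forall fun p => (hg'e p).symm)
  have hU : IsOpen (Set.Ioo 0 a ×ˢ Set.univ : Set (ℝ × E n)) := isOpen_Ioo.prod isOpen_univ
  have := hU.ae_eq_zero_of_integral_contDiff_smul_eq_zero (μ := μ')
    (hg'.locallyIntegrable.locallyIntegrableOn _) (fun φ h1 h2 h3 => by
      rw [he.integral_map]
      simp only [hg'e, smul_eq_mul]
      simpa only [mul_comm] using h φ ⟨h1, h2, h3⟩)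
  rw [he.ae_map_iff] at this
  filter_upwards [this, ae_mem_Ioo n a] with p hp hp'
  simpa [hg'e] using hp ⟨hp', trivial⟩

lemma inner_L2 (v w : L2 n a) : inner ℝ v w = ∫ p, v p * w p ∂(wMeasure n a) := by
  rw [L2.inner_def]
  simp [mul_comm]

/-- The space of test functions. -/
def testSpace (n : ℕ) (a : ℝ) : Submodule ℝ (ℝ × E n → ℝ) where
  carrier := {φ | IsTest n a φ}
  add_mem' h h' := h.add h'
  zero_mem' := IsTest.zero
  smul_mem' c _ h := h.smul c

/-- The class in `L²` of a test function. -/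
def toL2 : testSpace n a →ₗ[ℝ] L2 n a where
  toFun φ := (IsTest.memLp φ.2 2).toLp _
  map_add' _ _ := rfl
  map_smul' _ _ := rfl

lemma coeFn_toL2 (φ : testSpace n a) :
    toL2 φ =ᵐ[wMeasure n a] fun p => φ.1 (emb p) := MemLp.coeFn_toLp (IsTest.memLp φ.2 2)

lemma inner_toL2 (v : L2 n a) (φ : testSpace n a) :
    inner ℝ v (toL2 φ) = ∫ p, v p * φ.1 (emb p) ∂(wMeasure n a) := by
  rw [inner_L2]
  refine integral_congr_ae ?_
  filter_upwards [coeFn_toL2 φ] with p hp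
  rw [hp]

lemma inner_toL2_toL2 (φ ψ : testSpace n a) :
    inner ℝ (toL2 φ) (toL2 ψ) = ∫ p, φ.1 (emb p) * ψ.1 (emb p) ∂(wMeasure n a) := by
  rw [inner_toL2]
  refine integral_congr_ae ?_
  filter_upwards [coeFn_toL2 φ] with p hp
  rw [hp]

lemma eq_zero_of_inner_toL2 {v : L2 n a} (h : ∀ φ : testSpace n a, inner ℝ v (toL2 φ) = 0) :
    v = 0 := by
  have := ae_eq_zero_of_integral_test (integrable_L2 v) fun φ hφ => by
    rw [← h ⟨φ, hφ⟩, inner_toL2]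
  exact Lp.ext (this.trans (Lp.coeFn_zero ..).symm)

lemma ext_inner_toL2 {v w : L2 n a}
    (h : ∀ φ : testSpace n a, inner ℝ v (toL2 φ) = inner ℝ w (toL2 φ)) : v = w := by
  rw [← sub_eq_zero]
  exact eq_zero_of_inner_toL2 fun φ => by rw [inner_sub_left, h, sub_self]

lemma denseRange_toL2 : DenseRange (toL2 (n := n) (a := a)) := by
  have h : (LinearMap.range (toL2 (n := n) (a := a))).topologicalClosure = ⊤ := by
    rw [Submodule.topologicalClosure_eq_top_iff, Submodule.eq_bot_iff]
    intro v hv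
    refine eq_zero_of_inner_toL2 fun φ => ?_
    rw [real_inner_comm]
    exact hv _ ⟨φ, rfl⟩
  have h' := Submodule.dense_iff_topologicalClosure_eq_top.2 h
  rwa [LinearMap.coe_range] at h'

end Measure

/-! ### Radial integration by parts and the Hardy inequality -/

section Radial

variable {n : ℕ} {a : ℝ} {φ ψ : ℝ × E n → ℝ}

lemma IsTest.differentiable (h : IsTest n a φ) : Differentiable ℝ φ :=
  h.smooth.differentiable (by simp)

lemma hasDerivAt_fst (h : IsTest n a φ) (x : ℝ) (θ : E n) :
    HasDerivAt (fun x => φ (x, θ)) (dx φ (x, θ)) x :=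
  (h.differentiable (x, θ)).hasFDerivAt.comp_hasDerivAt x
    ((hasDerivAt_id x).prodMk (hasDerivAt_const x θ))

lemma IsTest.integrable_mul_fst (h : IsTest n a φ) (θ : E n) :
    Integrable (fun x : ℝ => x * φ (x, θ)) := by
  refine Continuous.integrable_of_hasCompactSupport ?_ ?_
  · exact continuous_id.mul (h.smooth.continuous.comp (continuous_id.prodMk continuous_const))
  · refine HasCompactSupport.intro (isCompact_Icc (a := 0) (b := a)) fun x hx => ?_
    rw [h.eq_zero (q := (x, θ)) fun hx' => hx (Set.Ioo_subset_Icc_self hx'), mul_zero]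

/-- For `α = 1` the operator is `x⁻¹ ∂_x (x φ)`, a total derivative with respect to the weight `x
dx`. -/
lemma integral_cD_one (h : IsTest n a φ) :
    ∫ p, cD 1 φ (emb p) ∂(wMeasure n a) = 0 := by
  have hD := h.cD 1
  have hi := hD.integrable
  unfold wMeasure at hi ⊢
  rw [integral_prod_symm _ hi]
  refine integral_eq_zero_of_ae (Filter.Eventually.of_forall fun θ => ?_)
  have h1 : ∫ x, cD 1 φ (emb (x, θ))
      ∂((volume.restrict (Set.Ioo 0 a)).withDensity fun x => ENNReal.ofReal x) =
      ∫ x in Set.Ioo 0 a, x * cD 1 φ (x, (θ : E n)) := by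
    rw [integral_withDensity_eq_integral_toReal_smul (by fun_prop)
      (Filter.Eventually.of_forall fun x => ENNReal.ofReal_lt_top)]
    refine setIntegral_congr_fun measurableSet_Ioo fun x hx => ?_
    simp [ENNReal.toReal_ofReal hx.1.le, emb]
  change ∫ x, cD 1 φ (emb (x, θ))
      ∂((volume.restrict (Set.Ioo 0 a)).withDensity fun x => ENNReal.ofReal x) = 0
  rw [h1, setIntegral_eq_integral_of_forall_compl_eq_zero fun x hx => by
    rw [hD.eq_zero (q := (x, (θ : E n))) hx, mul_zero]]
  refine integral_eq_zero_of_hasDerivAt_of_integrable (f := fun x => x * φ (x, (θ : E n)))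
    (fun x => ?_) (hD.integrable_mul_fst θ) (h.integrable_mul_fst θ)
  refine ((hasDerivAt_id' x).fun_mul (hasDerivAt_fst h x (θ : E n))).congr_deriv ?_
  by_cases hx : x = 0
  · simp [hx, h.eq_zero (q := (0, (θ : E n)))]
  · simp only [cD]
    field_simp
    ring

lemma dx_mul (h : IsTest n a φ) (h' : IsTest n a ψ) (q : ℝ × E n) :
    dx (fun q => φ q * ψ q) q = φ q * dx ψ q + ψ q * dx φ q := by
  unfold dx
  rw [fderiv_fun_mul (h.differentiable q) (h'.differentiable q)]
  simp

/-- The difference of the two integrands is `D_1(φ ψ)`, whose integral vanishes. -/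
lemma integral_cD_mul (α : ℝ) (h : IsTest n a φ) (h' : IsTest n a ψ) :
    ∫ p, cD α φ (emb p) * ψ (emb p) ∂(wMeasure n a) =
      ∫ p, φ (emb p) * cDstar α ψ (emb p) ∂(wMeasure n a) := by
  rw [← sub_eq_zero, ← integral_sub (h'.integrable_mul (h.cD α).integrable)
    ((h'.cDstar α).integrable_mul h.integrable),
    ← integral_cD_one (h'.mul_left h.smooth)]
  refine integral_congr_ae ?_
  filter_upwards [ae_mem_Ioo n a] with p hp
  have : (emb p).1 ≠ 0 := hp.1.ne'
  simp only [cD, cDstar, dx_mul h h']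
  field_simp
  ring

lemma dx_div_fst (h : IsTest n a φ) {q : ℝ × E n} (hq : q.1 ≠ 0) :
    dx (fun q => φ q / q.1) q = dx φ q / q.1 - φ q / q.1 ^ 2 := by
  have h1 := hasDerivAt_fst h.div_fst q.1 q.2
  have h2 := (hasDerivAt_fst h q.1 q.2).div (hasDerivAt_id q.1) hq
  have := h1.unique h2
  simp only [Prod.mk.eta, id] at this
  rw [this]
  field_simp

/-- In the expansion of `(D_x φ)²` the cross term `2 α φ ∂_x φ / x` is exactly `α D_1(φ²/x)`. It
integrates to zero; it remains to drop `(∂_x φ)²` and to use `x ≤ a`. -/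
lemma hardy {α : ℝ} (hα : 0 < α) (ha : 0 < a) (h : IsTest n a φ) :
    (α / a) ^ 2 * ∫ p, φ (emb p) * φ (emb p) ∂(wMeasure n a) ≤
      ∫ p, cD α φ (emb p) * cD α φ (emb p) ∂(wMeasure n a) := by
  have hχ : IsTest n a (fun q => φ q * φ q / q.1) := (h.mul_left h.smooth).div_fst
  have hD := h.cD α
  have key := integral_cD_one hχ
  have h_int : Integrable (fun p => (α / a) ^ 2 * (φ (emb p) * φ (emb p)) +
      α * cD 1 (fun q => φ q * φ q / q.1) (emb p)) (wMeasure n a) :=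
    ((h.integrable_mul h.integrable).const_mul _).add ((hχ.cD 1).integrable.const_mul _)
  have h3 := integral_mono_ae h_int (hD.integrable_mul hD.integrable) (by
    filter_upwards [ae_mem_Ioo n a] with p hp
    have hx : 0 < (emb p).1 := hp.1
    have hxa : (emb p).1 ≤ a := hp.2.le
    have hq := hx.ne'
    simp only [cD]
    rw [dx_div_fst (h.mul_left h.smooth) hq, dx_mul h h]
    have h4 : (α / a) ^ 2 ≤ (α / (emb p).1) ^ 2 := by gcongr
    have h5 : (α / a) ^ 2 * (φ (emb p) * φ (emb p)) ≤
        (α / (emb p).1) ^ 2 * (φ (emb p) * φ (emb p)) :=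
      mul_le_mul_of_nonneg_right h4 (mul_self_nonneg _)
    refine (add_le_add_left h5 _).trans ?_
    have h6 : (dx φ (emb p) + α / (emb p).1 * φ (emb p)) *
        (dx φ (emb p) + α / (emb p).1 * φ (emb p)) -
        ((α / (emb p).1) ^ 2 * (φ (emb p) * φ (emb p)) +
          α * ((φ (emb p) * dx φ (emb p) + φ (emb p) * dx φ (emb p)) / (emb p).1 -
            φ (emb p) * φ (emb p) / (emb p).1 ^ 2 +
            1 / (emb p).1 * (φ (emb p) * φ (emb p) / (emb p).1))) =
        dx φ (emb p) * dx φ (emb p) := by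
      field_simp
      ring
    nlinarith [mul_self_nonneg (dx φ (emb p))])
  rw [integral_add ((h.integrable_mul h.integrable).const_mul _)
    ((hχ.cD 1).integrable.const_mul _), integral_const_mul, integral_const_mul, key] at h3
  simpa using h3

end Radial

/-! ### Commutation of radial and angular derivatives -/

section Commute

variable {n : ℕ} {a : ℝ} {φ ψ : ℝ × E n → ℝ}

/-- The rotation field does not depend on `x`, so only the symmetry of the second derivative is
left. -/
lemma dx_cY (i j : Fin (n - 1)) (h : IsTest n a φ) : dx (cY i j φ) = cY i j (dx φ) := by
  ext q
  have hd : DifferentiableAt ℝ (fderiv ℝ φ) q :=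
    (h.smooth.fderiv_right (m := ∞) (by simp)).differentiable (by simp) q
  have hX : ContDiff ℝ ∞ (fun q : ℝ × E n => ((0 : ℝ), rotField i j q.2)) :=
    contDiff_const.prodMk ((contDiff_rotField i j).comp contDiff_snd)
  have hXd := hX.differentiable (by simp) q
  have h1 : fderiv ℝ (cY i j φ) q = _ := fderiv_clm_apply hd hXd
  have h2 : fderiv ℝ (dx φ) q = _ := fderiv_clm_apply hd (differentiableAt_const _)
  have h3 : fderiv ℝ (fun q : ℝ × E n => ((0 : ℝ), rotField i j q.2)) q (1, 0) = 0 := by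
    have h4 : HasDerivAt (fun _ : ℝ => ((0 : ℝ), rotField i j q.2)) 0 q.1 :=
      hasDerivAt_const _ _
    have h5 := hXd.hasFDerivAt.comp_hasDerivAt q.1
      ((hasDerivAt_id q.1).prodMk (hasDerivAt_const q.1 q.2))
    exact h5.unique h4
  have hsymm : IsSymmSndFDerivAt ℝ φ q := h.smooth.contDiffAt.isSymmSndFDerivAt
    (by simpa using WithTop.coe_le_coe.2 (le_top : (2 : ℕ∞) ≤ ⊤))
  have e1 : dx (cY i j φ) q = fderiv ℝ (cY i j φ) q (1, 0) := rfl
  have e2 : cY i j (dx φ) q = fderiv ℝ (dx φ) q (0, rotField i j q.2) := rfl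
  rw [e1, e2, h1, h2]
  simp [h3, hsymm.eq (1, 0)]

lemma cY_div_fst (i j : Fin (n - 1)) (h : IsTest n a φ) (q : ℝ × E n) :
    cY i j (fun q => φ q / q.1) q = cY i j φ q / q.1 := by
  have h3 : (fun q : ℝ × E n => φ q / q.1) = fun q => φ q * q.1⁻¹ := by
    ext; rw [div_eq_mul_inv]
  by_cases hq : q ∈ tsupport φ
  · have hx : q.1 ≠ 0 := (h.support hq).1.1.ne'
    have h1 : HasFDerivAt (fun q : ℝ × E n => q.1⁻¹) _ q :=
      (hasFDerivAt_inv hx).comp q hasFDerivAt_fst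
    have h2 := (h.differentiable q).hasFDerivAt.fun_mul h1
    unfold cY
    rw [h3, h2.fderiv]
    simp [div_eq_mul_inv, mul_comm]
  · have hq' : q ∉ tsupport (fun q : ℝ × E n => φ q / q.1) := fun hq' => hq (by
      rw [h3] at hq'; exact tsupport_mul_subset_left hq')
    unfold cY
    rw [fderiv_eq_zero_of_notMem hq, fderiv_eq_zero_of_notMem hq']
    simp

end Commute

/-! ### The derivatives as operators on test functions -/

section Operators

variable {n : ℕ} {a : ℝ}

/-- `D_x` on test functions. -/
def opD (α : ℝ) : testSpace n a →ₗ[ℝ] testSpace n a where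
  toFun φ := ⟨cD α φ.1, IsTest.cD α φ.2⟩
  map_add' φ ψ := by
    ext q
    have := fderiv_add (IsTest.differentiable φ.2 q) (IsTest.differentiable ψ.2 q)
    simp only [Submodule.coe_add, cD, dx, Pi.add_apply, this, add_apply]
    ring
  map_smul' c φ := by
    ext q
    have := fderiv_const_smul (IsTest.differentiable φ.2 q) c
    simp only [Submodule.coe_smul, cD, dx, Pi.smul_apply, this, smul_eq_mul, RingHom.id_apply,
      smul_apply]
    ring

/-- `D_x^*` on test functions. -/
def opDstar (α : ℝ) : testSpace n a →ₗ[ℝ] testSpace n a where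
  toFun φ := ⟨cDstar α φ.1, IsTest.cDstar α φ.2⟩
  map_add' φ ψ := by
    ext q
    have := fderiv_add (IsTest.differentiable φ.2 q) (IsTest.differentiable ψ.2 q)
    simp only [Submodule.coe_add, cDstar, dx, Pi.add_apply, this, add_apply]
    ring
  map_smul' c φ := by
    ext q
    have := fderiv_const_smul (IsTest.differentiable φ.2 q) c
    simp only [Submodule.coe_smul, cDstar, dx, Pi.smul_apply, this, smul_eq_mul,
      RingHom.id_apply, smul_apply]
    ring

/-- `Y_{ij}` on test functions. -/
def opY (i j : Fin (n - 1)) : testSpace n a →ₗ[ℝ] testSpace n a where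
  toFun φ := ⟨cY i j φ.1, IsTest.cY i j φ.2⟩
  map_add' φ ψ := by
    ext q
    have := fderiv_add (IsTest.differentiable φ.2 q) (IsTest.differentiable ψ.2 q)
    simp only [Submodule.coe_add, cY, Pi.add_apply, this, add_apply]
  map_smul' c φ := by
    ext q
    have := fderiv_const_smul (IsTest.differentiable φ.2 q) c
    simp only [Submodule.coe_smul, cY, Pi.smul_apply, this, smul_eq_mul, RingHom.id_apply,
      smul_apply]

/-- Division by `x` on test functions. -/
def opDiv (φ : testSpace n a) : testSpace n a := ⟨fun q => φ.1 q / q.1, IsTest.div_fst φ.2⟩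

/-- `∂_x` on test functions. -/
def opDx (φ : testSpace n a) : testSpace n a := ⟨dx φ.1, IsTest.dx φ.2⟩

lemma opD_eq (α : ℝ) (φ : testSpace n a) : opD α φ = opDx φ + α • opDiv φ := by
  ext q
  simp [opD, opDx, opDiv, cD]
  ring

lemma opDstar_eq (α : ℝ) (φ : testSpace n a) :
    opDstar α φ = -opDx φ + (α - 1) • opDiv φ := by
  ext q
  simp [opDstar, opDx, opDiv, cDstar]
  ring

lemma opY_opDx (i j : Fin (n - 1)) (φ : testSpace n a) : opY i j (opDx φ) = opDx (opY i j φ) :=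
  Subtype.ext (dx_cY i j φ.2).symm

lemma opY_opDiv (i j : Fin (n - 1)) (φ : testSpace n a) :
    opY i j (opDiv φ) = opDiv (opY i j φ) :=
  Subtype.ext (funext fun q => cY_div_fst i j φ.2 q)

lemma opY_opD (α : ℝ) (i j : Fin (n - 1)) (φ : testSpace n a) :
    opY i j (opD α φ) = opD α (opY i j φ) := by
  rw [opD_eq, opD_eq, map_add, map_smul, opY_opDx, opY_opDiv]

lemma opY_opDstar (α : ℝ) (i j : Fin (n - 1)) (φ : testSpace n a) :
    opY i j (opDstar α φ) = opDstar α (opY i j φ) := by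
  rw [opDstar_eq, opDstar_eq, map_add, map_neg, map_smul, opY_opDx, opY_opDiv]

lemma inner_opD (α : ℝ) (φ ψ : testSpace n a) :
    inner ℝ (toL2 (opD α φ)) (toL2 ψ) = inner ℝ (toL2 φ) (toL2 (opDstar α ψ)) := by
  rw [inner_toL2_toL2, inner_toL2_toL2]
  exact integral_cD_mul α φ.2 ψ.2

lemma norm_toL2_le {α : ℝ} (hα : 0 < α) (ha : 0 < a) (φ : testSpace n a) :
    α / a * ‖toL2 φ‖ ≤ ‖toL2 (opD α φ)‖ := by
  have h := hardy hα ha φ.2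
  refine le_of_sq_le_sq ?_ (norm_nonneg _)
  rw [mul_pow, ← real_inner_self_eq_norm_sq, ← real_inner_self_eq_norm_sq, inner_toL2_toL2,
    inner_toL2_toL2]
  exact h

lemma hasD_iff {α : ℝ} {v g : L2 n a} :
    HasD α v g ↔ ∀ φ : testSpace n a, inner ℝ v (toL2 (opDstar α φ)) = inner ℝ g (toL2 φ) := by
  simp only [inner_toL2]
  exact ⟨fun h φ => h φ.1 φ.2, fun h φ hφ => h ⟨φ, hφ⟩⟩

lemma hasDstar_iff {α : ℝ} {v g : L2 n a} :
    HasDstar α v g ↔ ∀ φ : testSpace n a, inner ℝ v (toL2 (opD α φ)) = inner ℝ g (toL2 φ) := by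
  simp only [inner_toL2]
  exact ⟨fun h φ => h φ.1 φ.2, fun h φ hφ => h ⟨φ, hφ⟩⟩

lemma hasY_iff {i j : Fin (n - 1)} {v g : L2 n a} :
    HasY i j v g ↔ ∀ φ : testSpace n a, inner ℝ v (toL2 (opY i j φ)) = -inner ℝ g (toL2 φ) := by
  simp only [inner_toL2]
  exact ⟨fun h φ => h φ.1 φ.2, fun h φ hφ => h ⟨φ, hφ⟩⟩

end Operators

/-! ### Plane rotations -/

section Rotation

variable {n : ℕ} {a : ℝ}

/-- The pairs `i < j` that index the rotation fields. -/
abbrev Pairs (n : ℕ) : Type := {p : Fin (n - 1) × Fin (n - 1) // p.1 < p.2}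

/-- The rotation by the angle `t` in the plane of the coordinates `i`, `j`, as a linear map. -/
def rotLin (i j : Fin (n - 1)) (t : ℝ) : E n →ₗ[ℝ] E n where
  toFun θ := θ + ((Real.cos t - 1) * θ i - Real.sin t * θ j) • EuclideanSpace.single i (1 : ℝ)
    + (Real.sin t * θ i + (Real.cos t - 1) * θ j) • EuclideanSpace.single j (1 : ℝ)
  map_add' θ η := by
    simp only [PiLp.add_apply]
    module
  map_smul' c θ := by
    simp only [PiLp.smul_apply, smul_eq_mul, RingHom.id_apply]
    module

lemma rotLin_apply (i j : Fin (n - 1)) (t : ℝ) (θ : E n) : rotLin i j t θ =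
    θ + ((Real.cos t - 1) * θ i - Real.sin t * θ j) • EuclideanSpace.single i (1 : ℝ)
    + (Real.sin t * θ i + (Real.cos t - 1) * θ j) • EuclideanSpace.single j (1 : ℝ) := rfl

lemma rotLin_apply_left {i j : Fin (n - 1)} (hij : i ≠ j) (t : ℝ) (θ : E n) :
    rotLin i j t θ i = Real.cos t * θ i - Real.sin t * θ j := by
  simp [rotLin_apply, hij]
  ring

lemma rotLin_apply_right {i j : Fin (n - 1)} (hij : i ≠ j) (t : ℝ) (θ : E n) :
    rotLin i j t θ j = Real.sin t * θ i + Real.cos t * θ j := by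
  simp [rotLin_apply, hij.symm]
  ring

lemma rotLin_neg_rotLin {i j : Fin (n - 1)} (hij : i ≠ j) (t : ℝ) (θ : E n) :
    rotLin i j (-t) (rotLin i j t θ) = θ := by
  rw [rotLin_apply i j (-t), rotLin_apply_left hij, rotLin_apply_right hij, Real.cos_neg,
    Real.sin_neg, rotLin_apply i j t]
  have h := Real.sin_sq_add_cos_sq t
  have h1 : (Real.cos t - 1) * (Real.cos t * θ i - Real.sin t * θ j) -
      -Real.sin t * (Real.sin t * θ i + Real.cos t * θ j) =
      -((Real.cos t - 1) * θ i - Real.sin t * θ j) := by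
    linear_combination θ i * h
  have h2 : -Real.sin t * (Real.cos t * θ i - Real.sin t * θ j) +
      (Real.cos t - 1) * (Real.sin t * θ i + Real.cos t * θ j) =
      -(Real.sin t * θ i + (Real.cos t - 1) * θ j) := by
    linear_combination θ j * h
  rw [h1, h2]
  module

/-- The adjoint of a plane rotation is its inverse, which makes `rot` an isometry. -/
lemma inner_rotLin (i j : Fin (n - 1)) (t : ℝ) (θ η : E n) :
    inner ℝ (rotLin i j t θ) η = inner ℝ θ (rotLin i j (-t) η) := by
  simp only [rotLin_apply, inner_add_left, inner_add_right, inner_smul_left, inner_smul_right,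
    EuclideanSpace.inner_single_left, EuclideanSpace.inner_single_right, Real.cos_neg,
    Real.sin_neg, map_one, one_mul, conj_trivial]
  ring

/-- The rotation by the angle `t` in the plane of the coordinates `i`, `j`. -/
def rot {i j : Fin (n - 1)} (hij : i ≠ j) (t : ℝ) : E n ≃ₗᵢ[ℝ] E n where
  toLinearEquiv := LinearEquiv.ofLinearMap (rotLin i j t) (rotLin i j (-t))
    (LinearMap.ext fun θ => by simpa using rotLin_neg_rotLin hij (-t) θ)
    (LinearMap.ext fun θ => rotLin_neg_rotLin hij t θ)
  norm_map' θ := by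
    have : ‖rotLin i j t θ‖ ^ 2 = ‖θ‖ ^ 2 := by
      rw [← real_inner_self_eq_norm_sq, inner_rotLin, rotLin_neg_rotLin hij,
        real_inner_self_eq_norm_sq]
    exact (sq_eq_sq₀ (norm_nonneg _) (norm_nonneg _)).1 this

lemma rot_apply {i j : Fin (n - 1)} (hij : i ≠ j) (t : ℝ) (θ : E n) :
    rot hij t θ = rotLin i j t θ := rfl

lemma rot_symm {i j : Fin (n - 1)} (hij : i ≠ j) (t : ℝ) : (rot hij t).symm = rot hij (-t) := by
  ext θ : 1
  rw [LinearIsometryEquiv.symm_apply_eq, rot_apply, rot_apply]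
  simpa using (rotLin_neg_rotLin hij (-t) θ).symm

lemma rot_zero {i j : Fin (n - 1)} (hij : i ≠ j) (θ : E n) : rot hij 0 θ = θ := by
  simp [rot_apply, rotLin_apply]

lemma hasDerivAt_rot {i j : Fin (n - 1)} (hij : i ≠ j) (t : ℝ) (θ : E n) :
    HasDerivAt (fun t => rot hij t θ) (rotField i j (rot hij t θ)) t := by
  have h1 : HasDerivAt (fun t => (Real.cos t - 1) * θ i - Real.sin t * θ j)
      (-Real.sin t * θ i - Real.cos t * θ j) t :=
    (((Real.hasDerivAt_cos t).sub_const 1).mul_const _).sub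
      ((Real.hasDerivAt_sin t).mul_const _)
  have h2 : HasDerivAt (fun t => Real.sin t * θ i + (Real.cos t - 1) * θ j)
      (Real.cos t * θ i + -Real.sin t * θ j) t :=
    ((Real.hasDerivAt_sin t).mul_const _).add
      (((Real.hasDerivAt_cos t).sub_const 1).mul_const _)
  refine (((h1.smul_const (EuclideanSpace.single i (1 : ℝ))).const_add θ).fun_add
    (h2.smul_const (EuclideanSpace.single j (1 : ℝ)))).congr_deriv ?_
  rw [rotField, rot_apply, rotLin_apply_left hij, rotLin_apply_right hij]
  module

end Rotation

/-! ### Invariance of the measure -/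

section Invariance

variable {n : ℕ} {a : ℝ}

/-- The action of a linear isometry on the sphere. -/
def sphereMap (R : E n ≃ₗᵢ[ℝ] E n) (θ : S n) : S n := ⟨R θ, by simp⟩

-- The surface measure of a set is defined through the volume of the cone over it; an isometry
-- carries cones to cones and preserves volume.
open scoped Pointwise in
lemma measurePreserving_sphereMap (R : E n ≃ₗᵢ[ℝ] E n) :
    MeasurePreserving (sphereMap R) (volume : Measure (E n)).toSphere
      (volume : Measure (E n)).toSphere := by
  have hm : Measurable (sphereMap R) :=
    ((R.continuous.comp continuous_subtype_val).subtype_mk _).measurable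
  refine ⟨hm, Measure.ext fun s hs => ?_⟩
  rw [Measure.map_apply hm hs, Measure.toSphere_apply' _ (hm hs), Measure.toSphere_apply' _ hs]
  have h : Set.Ioo (0 : ℝ) 1 • ((↑) '' (sphereMap R ⁻¹' s) : Set (E n)) =
      R ⁻¹' (Set.Ioo (0 : ℝ) 1 • ((↑) '' s)) := by
    ext η
    simp only [Set.mem_smul, Set.mem_image, Set.mem_preimage]
    constructor
    · rintro ⟨r, hr, _, ⟨θ, hθ, rfl⟩, rfl⟩
      exact ⟨r, hr, _, ⟨_, hθ, rfl⟩, by simp [sphereMap]⟩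
    · rintro ⟨r, hr, _, ⟨θ, hθ, rfl⟩, h⟩
      refine ⟨r, hr, _, ⟨⟨R.symm θ, by simp⟩, ?_, rfl⟩, ?_⟩
      · simpa [sphereMap] using hθ
      · apply R.injective
        simpa using h
  rw [h, R.measurePreserving.measure_preimage_emb R.toHomeomorph.measurableEmbedding]

lemma measurePreserving_rotate (R : E n ≃ₗᵢ[ℝ] E n) (a : ℝ) :
    MeasurePreserving (Prod.map id (sphereMap R)) (wMeasure n a) (wMeasure n a) :=
  (MeasurePreserving.id _).prod (measurePreserving_sphereMap R)

lemma integral_rotate (R : E n ≃ₗᵢ[ℝ] E n) {f : ℝ × E n → ℝ} (hf : Continuous f) :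
    ∫ p, f ((emb p).1, R (emb p).2) ∂(wMeasure n a) = ∫ p, f (emb p) ∂(wMeasure n a) := by
  have h := measurePreserving_rotate R a
  conv_rhs => rw [← h.map_eq]
  exact (integral_map h.measurable.aemeasurable
    (hf.comp continuous_emb).aestronglyMeasurable).symm

/-- The action of a linear isometry on test functions. -/
def opRot (R : E n ≃ₗᵢ[ℝ] E n) : testSpace n a →ₗ[ℝ] testSpace n a where
  toFun φ := ⟨rotate R φ.1, IsTest.rotate R φ.2⟩
  map_add' _ _ := rfl
  map_smul' _ _ := rfl

lemma opRot_apply (R : E n ≃ₗᵢ[ℝ] E n) (φ : testSpace n a) (q : ℝ × E n) :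
    (opRot R φ).1 q = φ.1 (q.1, R q.2) := rfl

lemma opRot_symm (R : E n ≃ₗᵢ[ℝ] E n) (φ : testSpace n a) : opRot R (opRot R.symm φ) = φ := by
  ext q
  simp [opRot_apply]

lemma inner_opRot (R : E n ≃ₗᵢ[ℝ] E n) (φ ψ : testSpace n a) :
    inner ℝ (toL2 (opRot R φ)) (toL2 (opRot R ψ)) = inner ℝ (toL2 φ) (toL2 ψ) := by
  rw [inner_toL2_toL2, inner_toL2_toL2]
  exact integral_rotate R (f := fun q => φ.1 q * ψ.1 q)
    (φ.2.smooth.continuous.mul ψ.2.smooth.continuous)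

lemma fderiv_rotate (R : E n ≃ₗᵢ[ℝ] E n) {φ : ℝ × E n → ℝ} (h : IsTest n a φ) (q v : ℝ × E n) :
    fderiv ℝ (rotate R φ) q v = fderiv ℝ φ (q.1, R q.2) (v.1, R v.2) := by
  have h1 : HasFDerivAt (fun q : ℝ × E n => (q.1, R q.2))
      ((ContinuousLinearMap.fst ℝ ℝ (E n)).prod
        ((R : E n →L[ℝ] E n).comp (ContinuousLinearMap.snd ℝ ℝ (E n)))) q :=
    hasFDerivAt_fst.prodMk ((R : E n →L[ℝ] E n).hasFDerivAt.comp q hasFDerivAt_snd)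
  have h2 : HasFDerivAt (rotate R φ) _ q :=
    (h.differentiable (q.1, R q.2)).hasFDerivAt.comp q h1
  rw [h2.fderiv]
  rfl

lemma opD_opRot (α : ℝ) (R : E n ≃ₗᵢ[ℝ] E n) (φ : testSpace n a) :
    opD α (opRot R φ) = opRot R (opD α φ) := by
  ext q
  have h : dx (rotate R φ.1) q = dx φ.1 (q.1, R q.2) := by
    simp [dx, fderiv_rotate R φ.2]
  change dx (rotate R φ.1) q + _ = dx φ.1 (q.1, R q.2) + _
  rw [h]
  rfl

/-- A symmetric sum over all pairs of indices in terms of the pairs `i < j`. -/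
lemma sum_pairs {M : Type*} [AddCommGroup M] {k : ℕ} (f : Fin k → Fin k → M)
    (hs : ∀ i j, f i j = f j i) (hd : ∀ i, f i i = 0) :
    ∑ i, ∑ j, f i j = 2 • ∑ p : {p : Fin k × Fin k // p.1 < p.2}, f p.1.1 p.1.2 := by
  have h0 : ∑ p : {p : Fin k × Fin k // p.1 < p.2}, f p.1.1 p.1.2 =
      ∑ i, ∑ j, if i < j then f i j else 0 := by
    rw [← Fintype.sum_prod_type' (f := fun i j => if i < j then f i j else 0),
      ← Finset.sum_filter]
    exact (Finset.sum_subtype (p := fun p : Fin k × Fin k => p.1 < p.2) _ (by simp)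
      (fun p => f p.1 p.2)).symm
  have h1 : ∑ i, ∑ j, f i j =
      ∑ i, ∑ j, ((if i < j then f i j else 0) + if j < i then f j i else 0) := by
    refine Finset.sum_congr rfl fun i _ => Finset.sum_congr rfl fun j _ => ?_
    rcases lt_trichotomy i j with h | h | h
    · simp [h, h.le]
    · simp [h, hd]
    · simp [h, h.le, hs i j]
  rw [h1]
  simp only [Finset.sum_add_distrib]
  rw [Finset.sum_comm (f := fun i j => if j < i then f j i else 0), h0, two_nsmul]

lemma inner_rotField (g θ : E n) (i j : Fin (n - 1)) :
    inner ℝ g (rotField i j θ) = θ i * g j - θ j * g i := by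
  simp [rotField, inner_sub_right, inner_smul_right, EuclideanSpace.inner_single_right]

/-- Lagrange's identity. -/
lemma sum_inner_rotField (g h θ : E n) (hθ : ‖θ‖ = 1) :
    ∑ p : Pairs n, inner ℝ g (rotField p.1.1 p.1.2 θ) * inner ℝ h (rotField p.1.1 p.1.2 θ) =
      inner ℝ g h - inner ℝ g θ * inner ℝ h θ := by
  have hs := sum_pairs (fun i j => inner ℝ g (rotField i j θ) * inner ℝ h (rotField i j θ))
    (fun i j => by simp only [inner_rotField]; ring) (fun i => by simp [inner_rotField])
  have h3 : ∀ u v : E n, inner ℝ u v = ∑ i, u i * v i := fun u v => by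
    simp [PiLp.inner_apply, mul_comm]
  have h1 : ∑ i, θ i * θ i = 1 := by
    have : inner ℝ θ θ = (1 : ℝ) := by rw [real_inner_self_eq_norm_sq, hθ, one_pow]
    rwa [h3] at this
  have h2 : ∑ i, ∑ j, inner ℝ g (rotField i j θ) * inner ℝ h (rotField i j θ) =
      2 * ((∑ i, θ i * θ i) * ∑ j, g j * h j) - 2 * ((∑ i, g i * θ i) * ∑ j, h j * θ j) := by
    -- Each product of sums is expanded twice, with the indices exchanged, to match the four terms
    -- of `(θ_i g_j - θ_j g_i)(θ_i h_j - θ_j h_i)`.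
    have e1 : (∑ i, θ i * θ i) * ∑ j, g j * h j = ∑ i, ∑ j, θ i * θ i * (g j * h j) :=
      Finset.sum_mul_sum ..
    have e2 : (∑ i, θ i * θ i) * ∑ j, g j * h j = ∑ i, ∑ j, θ j * θ j * (g i * h i) := by
      rw [e1, Finset.sum_comm]
    have e3 : (∑ i, g i * θ i) * ∑ j, h j * θ j = ∑ i, ∑ j, g i * θ i * (h j * θ j) :=
      Finset.sum_mul_sum ..
    have e4 : (∑ i, g i * θ i) * ∑ j, h j * θ j = ∑ i, ∑ j, g j * θ j * (h i * θ i) := by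
      rw [e3, Finset.sum_comm]
    rw [two_mul, two_mul]
    nth_rewrite 1 [e1]
    rw [e2]
    nth_rewrite 1 [e3]
    rw [e4, ← Finset.sum_add_distrib, ← Finset.sum_add_distrib, ← Finset.sum_sub_distrib]
    refine Finset.sum_congr rfl fun i _ => ?_
    rw [← Finset.sum_add_distrib, ← Finset.sum_add_distrib, ← Finset.sum_sub_distrib]
    refine Finset.sum_congr rfl fun j _ => ?_
    simp only [inner_rotField]
    ring
  rw [h2, h1, one_mul, ← h3, ← h3, ← h3, two_nsmul] at hs
  linarith

/-- The ambient gradient in the angular variable. -/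
def ambGrad (φ : ℝ × E n → ℝ) (q : ℝ × E n) : E n :=
  (InnerProductSpace.toDual ℝ (E n)).symm
    ((fderiv ℝ φ q).comp (ContinuousLinearMap.inr ℝ ℝ (E n)))

lemma inner_ambGrad (φ : ℝ × E n → ℝ) (q : ℝ × E n) (v : E n) :
    inner ℝ (ambGrad φ q) v = fderiv ℝ φ q (0, v) := by
  rw [ambGrad, InnerProductSpace.toDual_symm_apply]
  rfl

lemma ambGrad_rotate (R : E n ≃ₗᵢ[ℝ] E n) {φ : ℝ × E n → ℝ} (h : IsTest n a φ) (q : ℝ × E n) :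
    ambGrad (rotate R φ) q = R.symm (ambGrad φ (q.1, R q.2)) := by
  refine ext_inner_right ℝ fun v => ?_
  rw [inner_ambGrad, fderiv_rotate R h, ← R.inner_map_map, R.apply_symm_apply, inner_ambGrad]

/-- A single `Y_{ij}` does not commute with a general rotation. The sum does transform correctly: by
Lagrange's identity it is the inner product of the tangential parts of the gradients. -/
lemma sum_cY_rotate (R : E n ≃ₗᵢ[ℝ] E n) {φ ψ : ℝ × E n → ℝ} (h : IsTest n a φ)
    (h' : IsTest n a ψ) {q : ℝ × E n} (hq : ‖q.2‖ = 1) :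
    ∑ p : Pairs n, cY p.1.1 p.1.2 (rotate R φ) q * cY p.1.1 p.1.2 (rotate R ψ) q =
      ∑ p : Pairs n, cY p.1.1 p.1.2 φ (q.1, R q.2) * cY p.1.1 p.1.2 ψ (q.1, R q.2) := by
  simp only [cY, ← inner_ambGrad]
  rw [sum_inner_rotField _ _ _ hq, sum_inner_rotField _ _ _ (by simpa using hq),
    ambGrad_rotate R h, ambGrad_rotate R h', R.symm.inner_map_map]
  have e : ∀ u, inner ℝ (R.symm u) q.2 = inner ℝ u (R q.2) := fun u => by
    rw [← R.inner_map_map, R.apply_symm_apply]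
  rw [e, e]

lemma sum_inner_opY_opRot (R : E n ≃ₗᵢ[ℝ] E n) (φ ψ : testSpace n a) :
    ∑ p : Pairs n, inner ℝ (toL2 (opY p.1.1 p.1.2 (opRot R φ)))
        (toL2 (opY p.1.1 p.1.2 (opRot R ψ))) =
      ∑ p : Pairs n, inner ℝ (toL2 (opY p.1.1 p.1.2 φ)) (toL2 (opY p.1.1 p.1.2 ψ)) := by
  have hi : ∀ φ ψ : testSpace n a, ∀ p : Pairs n, Integrable (fun x =>
      (opY p.1.1 p.1.2 φ).1 (emb x) * (opY p.1.1 p.1.2 ψ).1 (emb x)) (wMeasure n a) :=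
    fun φ ψ p => (opY p.1.1 p.1.2 ψ).2.integrable_mul (opY p.1.1 p.1.2 φ).2.integrable
  simp only [inner_toL2_toL2]
  rw [← integral_finsetSum _ fun p _ => hi _ _ p, ← integral_finsetSum _ fun p _ => hi _ _ p,
    ← integral_rotate R (f := fun q => ∑ p : Pairs n,
      (opY p.1.1 p.1.2 φ).1 q * (opY p.1.1 p.1.2 ψ).1 q)
      (continuous_finsetSum _ fun p _ => (opY p.1.1 p.1.2 φ).2.smooth.continuous.mul
        (opY p.1.1 p.1.2 ψ).2.smooth.continuous)]
  refine integral_congr_ae (Filter.Eventually.of_forall fun p => ?_)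
  exact sum_cY_rotate R φ.2 ψ.2 (by simp [emb])

/-- The rotation fields generate the rotations. -/
lemma hasDerivAt_inner_opRot {i j : Fin (n - 1)} (hij : i ≠ j) (v : L2 n a)
    (φ : testSpace n a) :
    HasDerivAt (fun t => inner ℝ v (toL2 (opRot (rot hij t) φ)))
      (inner ℝ v (toL2 (opY i j φ))) 0 := by
  simp only [inner_toL2]
  obtain ⟨C, hC⟩ := IsTest.exists_bound (opY i j φ).2
  -- The derivative of `φ ∘ R_t` at any `t` is `(Y φ) ∘ R_t`, so a bound for `Y φ` dominates it
  -- uniformly in `t`.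
  have h := hasDerivAt_integral_of_dominated_loc_of_deriv_le (μ := wMeasure n a) (x₀ := (0 : ℝ))
    (F := fun t p => v p * (opRot (rot hij t) φ).1 (emb p))
    (F' := fun t p => v p * (opRot (rot hij t) (opY i j φ)).1 (emb p))
    (bound := fun p => ‖v p‖ * C) (s := Set.univ) Filter.univ_mem
    (Filter.Eventually.of_forall fun t =>
      (IsTest.integrable_mul (opRot (rot hij t) φ).2 (integrable_L2 v)).aestronglyMeasurable)
    (IsTest.integrable_mul (opRot (rot hij 0) φ).2 (integrable_L2 v))
    (IsTest.integrable_mul (opRot (rot hij 0) (opY i j φ)).2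
      (integrable_L2 v)).aestronglyMeasurable
    (Filter.Eventually.of_forall fun p t _ => by
      rw [norm_mul]
      exact mul_le_mul_of_nonneg_left (hC _) (norm_nonneg _))
    ((integrable_L2 v).norm.mul_const C)
    (Filter.Eventually.of_forall fun p t _ => HasDerivAt.const_mul _ (by
      have h1 : HasDerivAt (fun t => ((emb p).1, rot hij t (emb p).2))
          (0, rotField i j (rot hij t (emb p).2)) t :=
        (hasDerivAt_const t (emb p).1).prodMk (hasDerivAt_rot hij t (emb p).2)
      exact (IsTest.differentiable φ.2 _).hasFDerivAt.comp_hasDerivAt t h1))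
  have e : opRot (rot hij 0) (opY i j φ) = opY i j φ := by
    ext q
    simp [opRot_apply, rot_zero]
  simpa only [e] using h.2

lemma inner_opRot_left {i j : Fin (n - 1)} (hij : i ≠ j) (t : ℝ) (φ ψ : testSpace n a) :
    inner ℝ (toL2 (opRot (rot hij t) φ)) (toL2 ψ) =
      inner ℝ (toL2 φ) (toL2 (opRot (rot hij (-t)) ψ)) := by
  rw [← inner_opRot (rot hij t) φ, ← rot_symm, opRot_symm]

lemma opY_self (i : Fin (n - 1)) (φ : testSpace n a) : opY i i φ = 0 := by
  ext q
  have h : ((0 : ℝ), (0 : E n)) = 0 := rfl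
  simp [opY, cY, rotField, h]

lemma opY_swap (i j : Fin (n - 1)) (φ : testSpace n a) : opY j i φ = -opY i j φ := by
  ext q
  have : rotField j i q.2 = -rotField i j q.2 := by simp [rotField]
  have h2 : ((0 : ℝ), -rotField i j q.2) = -(0, rotField i j q.2) := by simp
  simp [opY, cY, this, h2, -Prod.neg_mk]

/-- Integration by parts on the sphere without charts: the invariance `(R_t φ, ψ) = (φ, R_{-t} ψ)`
is differentiated at `t = 0`. -/
lemma inner_opY (i j : Fin (n - 1)) (φ ψ : testSpace n a) :
    inner ℝ (toL2 (opY i j φ)) (toL2 ψ) = -inner ℝ (toL2 φ) (toL2 (opY i j ψ)) := by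
  by_cases hij : i = j
  · subst hij
    simp [opY_self]
  have h1 := hasDerivAt_inner_opRot hij (toL2 ψ) φ
  have h2 := hasDerivAt_inner_opRot hij (toL2 φ) ψ
  have h3 := HasDerivAt.scomp_of_eq (0 : ℝ) h2 (hasDerivAt_neg 0) neg_zero.symm
  have h4 : (fun t : ℝ => inner ℝ (toL2 ψ) (toL2 (opRot (rot hij t) φ))) =
      (fun t => inner ℝ (toL2 φ) (toL2 (opRot (rot hij t) ψ))) ∘ Neg.neg := by
    ext t
    rw [real_inner_comm, inner_opRot_left]
    rfl
  rw [h4] at h1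
  rw [real_inner_comm, h1.unique h3]
  simp

end Invariance

/-! ### The energy space -/

section Energy

variable {n : ℕ} {a : ℝ}

/-- The space of the triples `(v, D_x v, D_θ v)`. -/
abbrev Jet (n : ℕ) (a : ℝ) : Type := PiLp 2 fun _ : Option (Option (Pairs n)) => L2 n a

/-- The jet `(φ, D_x φ, D_θ φ)` of a test function. -/
def jet (α : ℝ) : testSpace n a →ₗ[ℝ] Jet n a where
  toFun φ := WithLp.toLp 2 fun o => match o with
    | none => toL2 φ
    | some none => toL2 (opD α φ)
    | some (some p) => toL2 (opY p.1.1 p.1.2 φ)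
  map_add' φ ψ := by
    ext1 o
    rcases o with _ | _ | p <;> simp
  map_smul' c φ := by
    ext1 o
    rcases o with _ | _ | p <;> simp

/-- The closure of the test functions in the energy norm. -/
def energySpace (α : ℝ) (n : ℕ) (a : ℝ) : Submodule ℝ (Jet n a) :=
  (LinearMap.range (jet α)).topologicalClosure

variable {α : ℝ}

instance completeSpace_energySpace : CompleteSpace (energySpace α n a) :=
  (Submodule.isClosed_topologicalClosure _).completeSpace_coe

/-- The function underlying an element of the energy space. -/
def val : energySpace α n a →L[ℝ] L2 n a :=
  (PiLp.proj 2 (fun _ : Option (Option (Pairs n)) => L2 n a) none).comp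
    (energySpace α n a).subtypeL

/-- The radial derivative `D_x` on the energy space. -/
def der : energySpace α n a →L[ℝ] L2 n a :=
  (PiLp.proj 2 (fun _ : Option (Option (Pairs n)) => L2 n a) (some none)).comp
    (energySpace α n a).subtypeL

/-- The angular derivatives on the energy space. -/
def ang (p : Pairs n) : energySpace α n a →L[ℝ] L2 n a :=
  (PiLp.proj 2 (fun _ : Option (Option (Pairs n)) => L2 n a) (some (some p))).comp
    (energySpace α n a).subtypeL

/-- A test function as an element of the energy space. -/
def ofTest (α : ℝ) : testSpace n a →ₗ[ℝ] energySpace α n a :=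
  (jet α).codRestrict _ fun φ => Submodule.le_topologicalClosure _ ⟨φ, rfl⟩

@[simp] lemma val_ofTest (φ : testSpace n a) : val (ofTest α φ) = toL2 φ := rfl

@[simp] lemma der_ofTest (φ : testSpace n a) : der (ofTest α φ) = toL2 (opD α φ) := rfl

@[simp] lemma ang_ofTest (p : Pairs n) (φ : testSpace n a) :
    ang p (ofTest α φ) = toL2 (opY p.1.1 p.1.2 φ) := rfl

lemma denseRange_ofTest : DenseRange (ofTest (n := n) (a := a) α) := by
  intro u
  rw [Topology.IsInducing.subtypeVal.closure_eq_preimage_closure_image]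
  exact closure_mono (by rintro _ ⟨φ, rfl⟩; exact ⟨ofTest α φ, ⟨φ, rfl⟩, rfl⟩) u.2

lemma inner_energySpace (u v : energySpace α n a) :
    inner ℝ u v = inner ℝ (val u) (val v) + (inner ℝ (der u) (der v)
      + ∑ p, inner ℝ (ang p u) (ang p v)) := by
  rw [Submodule.coe_inner, PiLp.inner_apply, Fintype.sum_option, Fintype.sum_option]
  rfl

/-- The inner product of `L²` as a continuous bilinear map. -/
def innerL2 : L2 n a →L[ℝ] L2 n a →L[ℝ] ℝ :=
  (innerₗ (L2 n a)).mkContinuous₂ 1 fun u v => by simpa using norm_inner_le_norm (𝕜 := ℝ) u v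

lemma innerL2_apply (u v : L2 n a) : innerL2 u v = inner ℝ u v := rfl

/-- The energy form `(D_x u, D_x v) + (D_θ u, D_θ v)`. -/
def form (α : ℝ) (n : ℕ) (a : ℝ) :
    energySpace α n a →L[ℝ] energySpace α n a →L[ℝ] ℝ :=
  innerL2.bilinearComp der der + ∑ p, innerL2.bilinearComp (ang p) (ang p)

lemma form_apply (u v : energySpace α n a) : form α n a u v =
    inner ℝ (der u) (der v) + ∑ p, inner ℝ (ang p u) (ang p v) := by
  simp [form, innerL2_apply, sum_apply]

lemma form_comm (u v : energySpace α n a) : form α n a u v = form α n a v u := by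
  rw [form_apply, form_apply, real_inner_comm]
  congr 1
  exact Finset.sum_congr rfl fun p _ => real_inner_comm _ _

lemma form_self (u : energySpace α n a) :
    form α n a u u = ‖der u‖ ^ 2 + ∑ p, ‖ang p u‖ ^ 2 := by
  simp only [form_apply, real_inner_self_eq_norm_sq]

lemma norm_der_sq_le (u : energySpace α n a) : ‖der u‖ ^ 2 ≤ form α n a u u := by
  rw [form_self]
  have : 0 ≤ ∑ p, ‖ang p u‖ ^ 2 := by positivity
  linarith

lemma sum_norm_ang_sq_le (u : energySpace α n a) : ∑ p, ‖ang p u‖ ^ 2 ≤ form α n a u u := by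
  rw [form_self]
  have : 0 ≤ ‖der u‖ ^ 2 := by positivity
  linarith

lemma norm_ang_sq_le (p : Pairs n) (u : energySpace α n a) :
    ‖ang p u‖ ^ 2 ≤ form α n a u u :=
  (Finset.single_le_sum (f := fun p => ‖ang p u‖ ^ 2) (fun _ _ => by positivity)
    (Finset.mem_univ p)).trans (sum_norm_ang_sq_le u)

/-! ### Coercivity and the solution operators. -/

lemma hardy_energySpace (hα : 0 < α) (ha : 0 < a) (u : energySpace α n a) :
    α / a * ‖val u‖ ≤ ‖der u‖ := by
  refine denseRange_ofTest.induction_on u ?_ fun φ => norm_toL2_le hα ha φ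
  exact isClosed_le (by fun_prop) (by fun_prop)

lemma norm_val_le (hα : 0 < α) (ha : 0 < a) (u : energySpace α n a) :
    ‖val u‖ ≤ a / α * ‖der u‖ := by
  have h := hardy_energySpace hα ha u
  have h2 : a / α * (α / a * ‖val u‖) ≤ a / α * ‖der u‖ := by gcongr
  calc ‖val u‖ = a / α * (α / a * ‖val u‖) := by field_simp
    _ ≤ _ := h2

/-- The squared norm is `‖val u‖²` plus the form, and Hardy bounds the first term by `(a/α)²` times
the form. -/
lemma isCoercive_form (hα : 0 < α) (ha : 0 < a) : IsCoercive (form α n a) := by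
  refine ⟨((a / α) ^ 2 + 1)⁻¹, by positivity, fun u => ?_⟩
  rw [mul_assoc, inv_mul_le_iff₀ (by positivity), ← pow_two, ← real_inner_self_eq_norm_sq,
    inner_energySpace, ← form_apply, real_inner_self_eq_norm_sq, add_mul, one_mul]
  gcongr
  calc ‖val u‖ ^ 2 ≤ (a / α * ‖der u‖) ^ 2 := by gcongr; exact norm_val_le hα ha u
    _ = (a / α) ^ 2 * ‖der u‖ ^ 2 := by ring
    _ ≤ _ := by gcongr; exact norm_der_sq_le u

lemma eq_of_form_eq (hα : 0 < α) (ha : 0 < a) {u v : energySpace α n a}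
    (h : ∀ φ, form α n a u (ofTest α φ) = form α n a v (ofTest α φ)) : u = v := by
  have h2 : ∀ w, form α n a (u - v) w = 0 := fun w => by
    refine denseRange_ofTest.induction_on w ?_ fun φ => by
      rw [map_sub, sub_apply, h, sub_self]
    exact isClosed_eq (by fun_prop) (by fun_prop)
  obtain ⟨C, hC, hc⟩ := isCoercive_form (n := n) hα ha
  have h3 := hc (u - v)
  rw [h2, mul_assoc] at h3
  rw [← sub_eq_zero, ← norm_eq_zero, ← mul_self_eq_zero]
  exact le_antisymm (nonpos_of_mul_nonpos_right h3 hC) (mul_self_nonneg _)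

/-- The operator that maps `F` to the solution `u` of `form u v = (F, T v)` for all `v`. -/
def solve (hα : 0 < α) (ha : 0 < a) (T : energySpace α n a →L[ℝ] L2 n a) :
    L2 n a →L[ℝ] energySpace α n a :=
  (isCoercive_form hα ha).continuousLinearEquivOfBilin.symm.toContinuousLinearMap.comp
    (ContinuousLinearMap.adjoint T)

lemma form_solve (hα : 0 < α) (ha : 0 < a) (T : energySpace α n a →L[ℝ] L2 n a) (F : L2 n a)
    (v : energySpace α n a) : form α n a (solve hα ha T F) v = inner ℝ F (T v) := by
  rw [← (isCoercive_form hα ha).continuousLinearEquivOfBilin_apply, solve]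
  rw [ContinuousLinearMap.comp_apply, ContinuousLinearEquiv.coe_coe,
    ContinuousLinearEquiv.apply_symm_apply, ContinuousLinearMap.adjoint_inner_left]

/-- The solution operator of the equation `D_x^* D_x u - Δ_θ u = F`. -/
abbrev sol (hα : 0 < α) (ha : 0 < a) : L2 n a →L[ℝ] energySpace α n a := solve hα ha val

/-- The solution operator of the equation `D_x^* D_x u - Δ_θ u = Y_p F`. -/
abbrev solY (hα : 0 < α) (ha : 0 < a) (p : Pairs n) : L2 n a →L[ℝ] energySpace α n a :=
  solve hα ha (-ang p)

lemma form_sol (hα : 0 < α) (ha : 0 < a) (F : L2 n a) (v : energySpace α n a) :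
    form α n a (sol hα ha F) v = inner ℝ F (val v) := form_solve ..

lemma form_solY (hα : 0 < α) (ha : 0 < a) (p : Pairs n) (F : L2 n a) (v : energySpace α n a) :
    form α n a (solY hα ha p F) v = -inner ℝ F (ang p v) := by
  rw [form_solve]
  simp

/-- The duality that turns pairings in `L²` into values of the energy form. -/
lemma inner_val_sol (hα : 0 < α) (ha : 0 < a) (u : energySpace α n a) (G : L2 n a) :
    inner ℝ (val u) G = form α n a u (sol hα ha G) := by
  rw [form_comm, form_sol, real_inner_comm]

lemma hasD_energySpace (u : energySpace α n a) : HasD α (val u) (der u) := by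
  rw [hasD_iff]
  intro φ
  refine denseRange_ofTest.induction_on u ?_ fun ψ => (inner_opD α ψ φ).symm
  exact isClosed_eq (by fun_prop) (by fun_prop)

lemma hasY_energySpace (p : Pairs n) (u : energySpace α n a) :
    HasY p.1.1 p.1.2 (val u) (ang p u) := by
  rw [hasY_iff]
  intro φ
  refine denseRange_ofTest.induction_on u ?_ fun ψ => ?_
  · exact isClosed_eq (by fun_prop) (by fun_prop)
  · simp only [val_ofTest, ang_ofTest]
    rw [inner_opY, neg_neg]

/-! ### Rotation invariance and angular regularity -/

lemma inner_ofTest_opRot (R : E n ≃ₗᵢ[ℝ] E n) (φ ψ : testSpace n a) :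
    inner ℝ (ofTest α (opRot R φ)) (ofTest α (opRot R ψ)) =
      inner ℝ (ofTest α φ) (ofTest α ψ) := by
  simp only [inner_energySpace, val_ofTest, der_ofTest, ang_ofTest]
  rw [inner_opRot, opD_opRot, opD_opRot, inner_opRot, sum_inner_opY_opRot]

lemma form_ofTest_opRot (R : E n ≃ₗᵢ[ℝ] E n) (φ ψ : testSpace n a) :
    form α n a (ofTest α (opRot R φ)) (ofTest α (opRot R ψ)) =
      form α n a (ofTest α φ) (ofTest α ψ) := by
  simp only [form_apply, der_ofTest, ang_ofTest]
  rw [opD_opRot, opD_opRot, inner_opRot, sum_inner_opY_opRot]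

/-- Rotation is an isometry of the test functions in the energy norm, so it extends to their
completion. Only the two properties of the rotated element that are needed later are recorded. -/
lemma exists_rotate_energySpace (R : E n ≃ₗᵢ[ℝ] E n) (u : energySpace α n a) :
    ∃ u' : energySpace α n a, ∀ ψ : testSpace n a,
      inner ℝ (val u') (toL2 (opRot R ψ)) = inner ℝ (val u) (toL2 ψ) ∧
      form α n a u' (ofTest α (opRot R ψ)) = form α n a u (ofTest α ψ) := by
  obtain ⟨s, hs, hlim⟩ := mem_closure_iff_seq_limit.1 (denseRange_ofTest u)
  choose φ hφ using hs
  obtain rfl : (fun k => ofTest α (φ k)) = s := funext hφ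
  have hn : ∀ χ : testSpace n a, ‖ofTest α (opRot R χ)‖ = ‖ofTest α χ‖ := fun χ => by
    rw [norm_eq_sqrt_real_inner, norm_eq_sqrt_real_inner, inner_ofTest_opRot]
  have hc : CauchySeq fun k => ofTest α (opRot R (φ k)) := by
    rw [Metric.cauchySeq_iff]
    intro ε hε
    obtain ⟨N, hN⟩ := Metric.cauchySeq_iff.1 hlim.cauchySeq ε hε
    refine ⟨N, fun i hi j hj => ?_⟩
    have := hN i hi j hj
    rw [dist_eq_norm, ← map_sub] at this ⊢
    rwa [← map_sub, hn]
  obtain ⟨u', hu'⟩ := cauchySeq_tendsto_of_complete hc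
  refine ⟨u', fun ψ => ⟨?_, ?_⟩⟩
  · have c : Continuous fun w : energySpace α n a => inner ℝ (val w) (toL2 (opRot R ψ)) := by
      fun_prop
    have c' : Continuous fun w : energySpace α n a => inner ℝ (val w) (toL2 ψ) := by fun_prop
    refine tendsto_nhds_unique ((c.tendsto u').comp hu') ?_
    exact ((c'.tendsto u).comp hlim).congr fun k => (inner_opRot R (φ k) ψ).symm
  · have c : Continuous fun w => form α n a w (ofTest α (opRot R ψ)) := by fun_prop
    have c' : Continuous fun w => form α n a w (ofTest α ψ) := by fun_prop
    refine tendsto_nhds_unique ((c.tendsto u').comp hu') ?_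
    exact ((c'.tendsto u).comp hlim).congr fun k => (form_ofTest_opRot R (φ k) ψ).symm

/-- The solution operator commutes with rotations. -/
lemma inner_sol_opRot (hα : 0 < α) (ha : 0 < a) (R : E n ≃ₗᵢ[ℝ] E n) (F G : testSpace n a) :
    inner ℝ (val (sol hα ha (toL2 (opRot R F)))) (toL2 (opRot R G)) =
      inner ℝ (val (sol hα ha (toL2 F))) (toL2 G) := by
  obtain ⟨u', hu'⟩ := exists_rotate_energySpace R (sol hα ha (toL2 F))
  have h : sol hα ha (toL2 (opRot R F)) = u' := by
    refine eq_of_form_eq hα ha fun φ => ?_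
    rw [← opRot_symm R φ, (hu' _).2, form_sol, form_sol, val_ofTest, val_ofTest, inner_opRot]
  rw [h, (hu' G).1]

lemma inner_sol_comm (hα : 0 < α) (ha : 0 < a) (F G : L2 n a) :
    inner ℝ (val (sol hα ha F)) G = inner ℝ F (val (sol hα ha G)) := by
  rw [inner_val_sol hα ha, form_sol]

/-- Symmetry and rotation invariance of the solution operator give `(S F, R_t G) = (S G, R_{-t} F)`.
Both sides are differentiated at `t = 0`, and `Y` is then moved to the solutions, which already have
first angular derivatives in `L²`. -/
lemma inner_ang_sol_toL2 (hα : 0 < α) (ha : 0 < a) (p : Pairs n) (F G : testSpace n a) :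
    inner ℝ (ang p (sol hα ha (toL2 F))) (toL2 G) =
      -inner ℝ (toL2 F) (ang p (sol hα ha (toL2 G))) := by
  have hij : p.1.1 ≠ p.1.2 := p.2.ne
  have h1 := hasDerivAt_inner_opRot hij (val (sol hα ha (toL2 F))) G
  have h2 := hasDerivAt_inner_opRot hij (val (sol hα ha (toL2 G))) F
  have h3 := HasDerivAt.scomp_of_eq (0 : ℝ) h2 (hasDerivAt_neg 0) neg_zero.symm
  have h4 : (fun t : ℝ => inner ℝ (val (sol hα ha (toL2 F))) (toL2 (opRot (rot hij t) G))) =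
      (fun t => inner ℝ (val (sol hα ha (toL2 G))) (toL2 (opRot (rot hij t) F))) ∘ Neg.neg := by
    ext t
    have := inner_sol_opRot hα ha (rot hij t) (opRot (rot hij t).symm F) G
    rw [opRot_symm, rot_symm] at this
    rw [this, inner_sol_comm, real_inner_comm]
    rfl
  rw [h4] at h1
  have h5 := h1.unique h3
  rw [hasY_iff.1 (hasY_energySpace p _), hasY_iff.1 (hasY_energySpace p _)] at h5
  rw [real_inner_comm _ (toL2 F), ← neg_eq_iff_eq_neg, h5]
  simp

lemma inner_ang_sol (hα : 0 < α) (ha : 0 < a) (p : Pairs n) (F : L2 n a) (G : testSpace n a) :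
    inner ℝ (ang p (sol hα ha F)) (toL2 G) = -inner ℝ F (ang p (sol hα ha (toL2 G))) := by
  refine denseRange_toL2.induction_on F ?_ fun F => inner_ang_sol_toL2 hα ha p F G
  exact isClosed_eq (by fun_prop) (by fun_prop)

/-- Angular regularity: the angular derivatives of a solution belong to the energy space. -/
lemma val_solY (hα : 0 < α) (ha : 0 < a) (p : Pairs n) (F : L2 n a) :
    val (solY hα ha p F) = ang p (sol hα ha F) := by
  refine ext_inner_toL2 fun G => ?_
  -- The functional `-(F, Y v)` defining `solY`, tested with `v = sol G`, is the left side; by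
  -- duality it is also the pairing of `val (solY F)` with `G`.
  rw [inner_ang_sol, inner_val_sol hα ha, form_solY]

lemma hasY_sol (hα : 0 < α) (ha : 0 < a) (p : Pairs n) (F : L2 n a) :
    HasY p.1.1 p.1.2 (val (sol hα ha F)) (val (solY hα ha p F)) := by
  rw [val_solY]
  exact hasY_energySpace p _

/-- Both right-hand sides define the same functional on test functions. With `val_solY` this says
that `Y` commutes with the solution operator. -/
lemma solY_eq_sol (hα : 0 < α) (ha : 0 < a) (p : Pairs n) {F F' : L2 n a}
    (h : HasY p.1.1 p.1.2 F F') : solY hα ha p F = sol hα ha F' := by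
  refine eq_of_form_eq hα ha fun φ => ?_
  rw [form_solY, form_sol, ang_ofTest, hasY_iff.1 h, neg_neg, val_ofTest]

/-- The solution is tested with itself, and the angular derivative that falls on it is absorbed by
the energy. No power of `a` appears, as Hardy is not used. -/
lemma form_solY_self_le (hα : 0 < α) (ha : 0 < a) (p : Pairs n) (F : L2 n a) :
    form α n a (solY hα ha p F) (solY hα ha p F) ≤ ‖F‖ ^ 2 := by
  set z := solY hα ha p F with hz
  have h1 : form α n a z z ≤ ‖F‖ * ‖ang p z‖ := by
    nth_rewrite 1 [hz]
    rw [form_solY, ← inner_neg_right]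
    simpa using real_inner_le_norm F (-ang p z)
  have h2 := norm_ang_sq_le p z
  nlinarith [sq_nonneg (‖F‖ - ‖ang p z‖)]

/-- Testing with the solution gives `‖D_x u‖² ≤ ‖F‖ ‖u‖`, and Hardy replaces `‖u‖` by `(a/α) ‖D_x
u‖`; one factor is cancelled. -/
lemma norm_der_sol_le (hα : 0 < α) (ha : 0 < a) (F : L2 n a) :
    ‖der (sol hα ha F)‖ ≤ a / α * ‖F‖ := by
  set u := sol hα ha F with hu
  have h1 : form α n a u u ≤ ‖F‖ * ‖val u‖ := by
    nth_rewrite 1 [hu]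
    rw [form_sol]
    exact real_inner_le_norm F (val u)
  have h2 := norm_der_sq_le u
  have h3 : ‖F‖ * ‖val u‖ ≤ ‖F‖ * (a / α * ‖der u‖) := by gcongr; exact norm_val_le hα ha u
  rcases (norm_nonneg (der u)).eq_or_lt with h0 | h0
  · rw [← h0]; positivity
  · refine le_of_mul_le_mul_right ?_ h0
    nlinarith

lemma norm_val_sol_le (hα : 0 < α) (ha : 0 < a) (F : L2 n a) :
    ‖val (sol hα ha F)‖ ≤ (a / α) ^ 2 * ‖F‖ := by
  refine (norm_val_le hα ha _).trans ?_
  rw [pow_two, mul_assoc]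
  gcongr
  exact norm_der_sol_le hα ha F

lemma form_sol_self_le (hα : 0 < α) (ha : 0 < a) (F : L2 n a) :
    form α n a (sol hα ha F) (sol hα ha F) ≤ (a / α) ^ 2 * ‖F‖ ^ 2 := by
  rw [form_sol]
  refine (real_inner_le_norm _ _).trans ?_
  have := mul_le_mul_of_nonneg_left (norm_val_sol_le hα ha F) (norm_nonneg F)
  linarith

/-- The radial second derivative of a solution, from the equation. -/
lemma hasDstar_der_sol (hα : 0 < α) (ha : 0 < a) (F : L2 n a) :
    HasDstar α (der (sol hα ha F)) (F + ∑ p, ang p (solY hα ha p F)) := by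
  rw [hasDstar_iff]
  intro φ
  have h := form_sol hα ha F (ofTest α φ)
  rw [form_apply, der_ofTest, val_ofTest] at h
  -- A second angular integration by parts, legitimate because the angular derivatives of the
  -- solution are again in the energy space.
  have h2 : ∑ p, inner ℝ (ang p (sol hα ha F)) (ang p (ofTest α φ)) =
      -∑ p, inner ℝ (ang p (solY hα ha p F)) (toL2 φ) := by
    rw [← Finset.sum_neg_distrib]
    refine Finset.sum_congr rfl fun p _ => ?_
    rw [ang_ofTest, ← val_solY, hasY_iff.1 (hasY_energySpace p _)]
  rw [inner_add_left, sum_inner]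
  linarith

end Energy

/-! ### Calculus of weak derivatives -/

section Weak

variable {n : ℕ} {a α : ℝ} {i j : Fin (n - 1)} {v v' g g' h h' : L2 n a}

lemma HasD.unique (h1 : HasD α v g) (h2 : HasD α v g') : g = g' :=
  ext_inner_toL2 fun φ => by rw [← hasD_iff.1 h1, hasD_iff.1 h2]

lemma HasDstar.unique (h1 : HasDstar α v g) (h2 : HasDstar α v g') : g = g' :=
  ext_inner_toL2 fun φ => by rw [← hasDstar_iff.1 h1, hasDstar_iff.1 h2]

lemma HasY.unique (h1 : HasY i j v g) (h2 : HasY i j v g') : g = g' :=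
  ext_inner_toL2 fun φ => by rw [← neg_inj, ← hasY_iff.1 h1, hasY_iff.1 h2]

lemma HasD.add (h1 : HasD α v g) (h2 : HasD α v' g') : HasD α (v + v') (g + g') := by
  rw [hasD_iff] at *
  intro φ
  rw [inner_add_left, inner_add_left, h1, h2]

lemma HasDstar.add (h1 : HasDstar α v g) (h2 : HasDstar α v' g') :
    HasDstar α (v + v') (g + g') := by
  rw [hasDstar_iff] at *
  intro φ
  rw [inner_add_left, inner_add_left, h1, h2]

lemma HasY.add (h1 : HasY i j v g) (h2 : HasY i j v' g') : HasY i j (v + v') (g + g') := by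
  rw [hasY_iff] at *
  intro φ
  rw [inner_add_left, inner_add_left, h1, h2, neg_add]

lemma HasY.smul (c : ℝ) (h1 : HasY i j v g) : HasY i j (c • v) (c • g) := by
  rw [hasY_iff] at *
  intro φ
  rw [inner_smul_left, inner_smul_left, h1, mul_neg]

lemma HasY.neg_swap (h1 : HasY i j v g) : HasY j i v (-g) := by
  rw [hasY_iff] at *
  intro φ
  rw [opY_swap, map_neg, inner_neg_right, h1, inner_neg_left]

lemma hasY_self (i : Fin (n - 1)) (v : L2 n a) : HasY i i v 0 := by
  rw [hasY_iff]
  intro φ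
  simp [opY_self]

/-- Weak derivatives along the fields with `i < j` give those along all rotation fields. -/
lemma exists_hasY {P : L2 n a → Prop} (h0 : P 0) (hneg : ∀ g, P g → P (-g))
    (h : ∀ p : Pairs n, ∃ g, HasY p.1.1 p.1.2 v g ∧ P g) (i j : Fin (n - 1)) :
    ∃ g, HasY i j v g ∧ P g := by
  rcases lt_trichotomy i j with hij | rfl | hij
  · exact h ⟨(i, j), hij⟩
  · exact ⟨0, hasY_self i v, h0⟩
  · obtain ⟨g, hg, hP⟩ := h ⟨(j, i), hij⟩
    exact ⟨-g, hg.neg_swap, hneg g hP⟩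

/-- Commutation on test functions is transferred by duality: `(g, Y φ) = (v, Y D_x^* φ) = -(v',
D_x^* φ) = -(g', φ)`. -/
lemma HasY.of_hasD (h1 : HasY i j v v') (h2 : HasD α v g) (h3 : HasD α v' g') :
    HasY i j g g' := by
  rw [hasY_iff, hasD_iff] at *
  intro φ
  rw [← h2, ← opY_opDstar, h1, h3]

lemma HasY.of_hasDstar (h1 : HasY i j v v') (h2 : HasDstar α v g) (h3 : HasDstar α v' g') :
    HasY i j g g' := by
  rw [hasY_iff, hasDstar_iff] at *
  intro φ
  rw [← h2, ← opY_opD, h1, h3]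

lemma HasDord.unique {k : ℕ} (h1 : HasDord α k v g) (h2 : HasDord α k v g') : g = g' := by
  induction k generalizing g g' with
  | zero => exact h1.trans h2.symm
  | succ k ih =>
    obtain ⟨f, hf, hg⟩ := h1
    obtain ⟨f', hf', hg'⟩ := h2
    obtain rfl := ih hf hf'
    split_ifs at hg hg'
    · exact hg.unique hg'
    · exact hg.unique hg'

lemma HasDord.add {k : ℕ} (h1 : HasDord α k v g) (h2 : HasDord α k v' g') :
    HasDord α k (v + v') (g + g') := by
  induction k generalizing g g' with
  | zero => exact congrArg₂ (· + ·) h1 h2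
  | succ k ih =>
    obtain ⟨f, hf, hg⟩ := h1
    obtain ⟨f', hf', hg'⟩ := h2
    refine ⟨f + f', ih hf hf', ?_⟩
    split_ifs at hg hg' ⊢
    · exact hg.add hg'
    · exact hg.add hg'

lemma hasD_zero : HasD α (0 : L2 n a) 0 := by simp [hasD_iff]

lemma hasDstar_zero : HasDstar α (0 : L2 n a) 0 := by simp [hasDstar_iff]

lemma hasDord_zero (k : ℕ) : HasDord α k (0 : L2 n a) 0 := by
  induction k with
  | zero => rfl
  | succ k ih =>
    refine ⟨0, ih, ?_⟩
    split_ifs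
    · exact hasD_zero
    · exact hasDstar_zero

lemma HasDord.sum {ι : Type*} (s : Finset ι) {k : ℕ} {f f' : ι → L2 n a}
    (h : ∀ x, HasDord α k (f x) (f' x)) : HasDord α k (∑ x ∈ s, f x) (∑ x ∈ s, f' x) := by
  classical
  induction s using Finset.induction_on with
  | empty => simpa using hasDord_zero k
  | insert x s hx ih =>
    rw [Finset.sum_insert hx, Finset.sum_insert hx]
    exact (h x).add ih

lemma hasDord_one : HasDord α 1 v g ↔ HasD α v g := by
  simp [HasDord]

/-- The operators `D_x^{(k)}` and `Y_{ij}` commute. -/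
lemma HasY.of_hasDord {k : ℕ} (h1 : HasY i j v v') (h2 : HasDord α k v g)
    (h3 : HasDord α k v' g') : HasY i j g g' := by
  induction k generalizing g g' with
  | zero =>
    obtain rfl := h2
    obtain rfl := h3
    exact h1
  | succ k ih =>
    obtain ⟨f, hf, hg⟩ := h2
    obtain ⟨f', hf', hg'⟩ := h3
    split_ifs at hg hg'
    · exact (ih hf hf').of_hasD hg hg'
    · exact (ih hf hf').of_hasDstar hg hg'

/-- `HasDord` adds operators at the outer end, whereas the equation provides the two innermost ones.
Prepending a pair leaves the alternation unchanged. -/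
lemma HasDord.comp_two {k : ℕ} (h1 : HasD α v h) (h2 : HasDstar α h h') (h3 : HasDord α k h' g) :
    HasDord α (k + 2) v g := by
  induction k generalizing g with
  | zero =>
    obtain rfl := h3
    exact ⟨h, hasDord_one.2 h1, by simpa using h2⟩
  | succ k ih =>
    obtain ⟨f, hf, hg⟩ := h3
    refine ⟨f, ih hf, ?_⟩
    have he : Even (k + 2) ↔ Even k := by simp [Nat.even_add]
    simpa only [he] using hg

/-- Weak derivatives are unique, so the choice in `Dord` is immaterial. -/
lemma Dord_eq {k : ℕ} (h1 : HasDord α k v g) : Dord α k v = g := by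
  have he : ∃ g, HasDord α k v g := ⟨g, h1⟩
  rw [Dord, dif_pos he]
  exact he.choose_spec.unique h1

lemma Y_eq (h1 : HasY i j v g) : Y i j v = g := by
  have he : ∃ g, HasY i j v g := ⟨g, h1⟩
  rw [Y, dif_pos he]
  exact he.choose_spec.unique h1

lemma HasDord.hasDord_Dord {k : ℕ} (h1 : HasDord α k v g) : HasDord α k v (Dord α k v) := by
  rwa [Dord_eq h1]

lemma HasY.hasY_Y (h1 : HasY i j v g) : HasY i j v (Y i j v) := by
  rwa [Y_eq h1]

end Weak

/-! ### The covariant gradient -/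

section Gradient

variable {n : ℕ} {a α : ℝ}

lemma contDiff_coord (i : Fin (n - 1)) : ContDiff ℝ ∞ (fun q : ℝ × E n => q.2 i) :=
  ((EuclideanSpace.proj (𝕜 := ℝ) i : E n →L[ℝ] ℝ).comp
    (ContinuousLinearMap.snd ℝ ℝ (E n))).contDiff

/-- Multiplication of a test function by a coordinate. -/
def coordMul (i : Fin (n - 1)) (φ : testSpace n a) : testSpace n a :=
  ⟨fun q => q.2 i * φ.1 q, IsTest.mul_left (contDiff_coord i) φ.2⟩

lemma opY_coordMul (i j k : Fin (n - 1)) (φ : testSpace n a) (q : ℝ × E n) :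
    (opY j k (coordMul i φ)).1 q = q.2 i * fderiv ℝ φ.1 q (0, rotField j k q.2)
      + rotField j k q.2 i * φ.1 q := by
  have h1 : HasFDerivAt (fun q : ℝ × E n => q.2 i)
      ((EuclideanSpace.proj (𝕜 := ℝ) i : E n →L[ℝ] ℝ).comp
        (ContinuousLinearMap.snd ℝ ℝ (E n))) q :=
    ((EuclideanSpace.proj (𝕜 := ℝ) i : E n →L[ℝ] ℝ).comp
      (ContinuousLinearMap.snd ℝ ℝ (E n))).hasFDerivAt
  have h2 := h1.fun_mul (IsTest.differentiable φ.2 q).hasFDerivAt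
  change fderiv ℝ (fun q => q.2 i * φ.1 q) q (0, rotField j k q.2) = _
  rw [h2.fderiv]
  simp [mul_comm]

/-- The adjoint form of `θ_i Y_{jk} + θ_j Y_{ki} + θ_k Y_{ij} = 0`, with the coordinates under the
derivatives; the extra terms from the product rule cancel as well. -/
lemma sum_cyclic_coordMul (i j k : Fin (n - 1)) (φ : testSpace n a) :
    opY j k (coordMul i φ) + opY k i (coordMul j φ) + opY i j (coordMul k φ) = 0 := by
  ext q
  simp only [Submodule.coe_add, Pi.add_apply, opY_coordMul, ZeroMemClass.coe_zero, Pi.zero_apply]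
  set L := (fderiv ℝ φ.1 q).comp (ContinuousLinearMap.inr ℝ ℝ (E n))
  have hL : ∀ x : E n, fderiv ℝ φ.1 q (0, x) = L x := fun x => rfl
  have h1 : q.2 i • rotField j k q.2 + q.2 j • rotField k i q.2 + q.2 k • rotField i j q.2 = 0 := by
    simp only [rotField]
    module
  have h2 : q.2 i * L (rotField j k q.2) + q.2 j * L (rotField k i q.2)
      + q.2 k * L (rotField i j q.2) = 0 := by
    have := congrArg L h1
    simpa using this
  have h3 : rotField j k q.2 i + rotField k i q.2 j + rotField i j q.2 k = 0 := by
    simp only [rotField, PiLp.sub_apply, PiLp.smul_apply, PiLp.single_apply, smul_eq_mul,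
      @eq_comm _ j i, @eq_comm _ k i, @eq_comm _ k j]
    ring
  simp only [hL]
  linear_combination h2 + φ.1 q * h3

/-- The cyclic identity for the rotation fields, for weak derivatives. -/
lemma ae_cyclic {v : L2 n a} (hv : ∀ i j, HasY i j v (Y i j v)) (i j k : Fin (n - 1)) :
    ∀ᵐ p ∂(wMeasure n a), (p.2 : E n) i * Y j k v p + (p.2 : E n) j * Y k i v p
      + (p.2 : E n) k * Y i j v p = 0 := by
  have hc : ∀ i, Continuous fun p : ℝ × S n => (p.2 : E n) i := fun i =>
    (contDiff_coord i).continuous.comp continuous_emb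
  have hi : ∀ i (g : L2 n a), Integrable (fun p => (p.2 : E n) i * g p) (wMeasure n a) :=
    fun i g => (integrable_L2 g).bdd_mul (c := 1) (hc i).aestronglyMeasurable
      (Filter.Eventually.of_forall fun p => (PiLp.norm_apply_le (p.2 : E n) i).trans (by simp))
  refine ae_eq_zero_of_integral_test (((hi _ _).add (hi _ _)).add (hi _ _)) fun φ hφ => ?_
  have hI : ∀ i (g : L2 n a), ∫ p, (p.2 : E n) i * g p * φ (emb p) ∂(wMeasure n a) =
      inner ℝ g (toL2 (coordMul i ⟨φ, hφ⟩)) := fun i g => by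
    rw [inner_toL2]
    refine integral_congr_ae (Filter.Eventually.of_forall fun p => ?_)
    simp only [coordMul, emb]
    ring
  have hm : ∀ i (g : L2 n a), Integrable (fun p => (p.2 : E n) i * g p * φ (emb p))
      (wMeasure n a) := fun i g => hφ.integrable_mul (hi i g)
  simp only [add_mul]
  refine (integral_add ((hm i (Y j k v)).add (hm j (Y k i v))) (hm k (Y i j v))).trans ?_
  rw [integral_add' (hm _ _) (hm _ _), hI, hI, hI,
    ← neg_inj, neg_add, neg_add, ← hasY_iff.1 (hv j k), ← hasY_iff.1 (hv k i),
    ← hasY_iff.1 (hv i j), ← inner_add_right, ← inner_add_right, ← map_add, ← map_add,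
    sum_cyclic_coordMul]
  simp

/-- The cyclic relation turns the left side `T` into `∑ A_{il} B_{il} - T`, and the full double sum
is twice the sum over `i < l`. It does the work of Lagrange's identity for weak derivatives, where
no ambient gradient is available. -/
lemma sum_gradient {k : ℕ} (θ : Fin k → ℝ) (hθ : ∑ i, θ i * θ i = 1) (A B : Fin k → Fin k → ℝ)
    (hA : ∀ i j, A j i = -A i j) (hB : ∀ i j, B j i = -B i j)
    (hc : ∀ i j l, θ i * B j l + θ j * B l i + θ l * B i j = 0) :
    ∑ l, (∑ i, θ i * A i l) * (∑ j, θ j * B j l) =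
      ∑ p : {p : Fin k × Fin k // p.1 < p.2}, A p.1.1 p.1.2 * B p.1.1 p.1.2 := by
  have hs := sum_pairs (fun i j => A i j * B i j) (fun i j => by rw [hA i j, hB i j]; ring)
    (fun i => by have := hA i i; have : A i i = 0 := by linarith
                 rw [this, zero_mul])
  have h1 : ∑ l, (∑ i, θ i * A i l) * (∑ j, θ j * B j l) =
      ∑ l, ∑ i, ∑ j, θ i * A i l * (θ j * B j l) :=
    Finset.sum_congr rfl fun l _ => Finset.sum_mul_sum ..
  have h2 : ∑ l, ∑ i, ∑ j, θ i * A i l * (θ j * B j l) =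
      ∑ l, ∑ i, ∑ j, (θ j * θ j) * (A i l * B i l)
        - ∑ l, ∑ i, ∑ j, θ l * A l i * (θ j * B j i) := by
    simp only [← Finset.sum_sub_distrib]
    refine Finset.sum_congr rfl fun l _ => Finset.sum_congr rfl fun i _ =>
      Finset.sum_congr rfl fun j _ => ?_
    rw [hA i l, hB i j]
    have := hc i j l
    rw [hB i l] at this
    linear_combination A i l * θ j * this
  have h3 : ∑ l, ∑ i, ∑ j, θ l * A l i * (θ j * B j i) =
      ∑ l, ∑ i, ∑ j, θ i * A i l * (θ j * B j l) := Finset.sum_comm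
  have h4 : ∑ l, ∑ i, ∑ j, (θ j * θ j) * (A i l * B i l) = ∑ i, ∑ l, A i l * B i l := by
    rw [Finset.sum_comm]
    simp only [← Finset.sum_mul, hθ, one_mul]
  rw [h3, h4, hs, two_nsmul] at h2
  rw [h1]
  linarith

lemma ae_Y_swap {v : L2 n a} (hv : ∀ i j, HasY i j v (Y i j v)) (i j : Fin (n - 1)) :
    ∀ᵐ p ∂(wMeasure n a), Y j i v p = -Y i j v p := by
  rw [Y_eq (hv i j).neg_swap]
  exact Lp.coeFn_neg _

lemma inner_angGrad {u v : L2 n a} (hu : ∀ i j, HasY i j u (Y i j u))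
    (hv : ∀ i j, HasY i j v (Y i j v)) :
    ∀ᵐ x ∂(wMeasure n a), inner ℝ (angGrad u x) (angGrad v x) =
      ∑ p : Pairs n, Y p.1.1 p.1.2 u x * Y p.1.1 p.1.2 v x := by
  have h1 := ae_all_iff.2 fun i => ae_all_iff.2 fun j => ae_Y_swap hu i j
  have h2 := ae_all_iff.2 fun i => ae_all_iff.2 fun j => ae_Y_swap hv i j
  have h3 := ae_all_iff.2 fun i => ae_all_iff.2 fun j => ae_all_iff.2 fun k => ae_cyclic hv i j k
  filter_upwards [h1, h2, h3] with x h1 h2 h3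
  have hθ : ∑ i, (x.2 : E n) i * (x.2 : E n) i = 1 := by
    have h : inner ℝ (x.2 : E n) (x.2 : E n) = (1 : ℝ) := by
      rw [real_inner_self_eq_norm_sq]
      simp
    exact (Finset.sum_congr rfl fun i _ => by simp [pow_two]).trans
      ((PiLp.inner_apply _ _).symm.trans h)
  rw [← sum_gradient _ hθ (fun i j => Y i j u x) (fun i j => Y i j v x) h1 h2 h3, PiLp.inner_apply]
  exact Finset.sum_congr rfl fun i _ => by
    rw [RCLike.inner_apply, conj_trivial, mul_comm]
    rfl

end Gradient

/-! ### Weak solutions and the energy space -/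

section Solution

variable {n : ℕ} {a α : ℝ}

lemma Dord_val (u : energySpace α n a) : Dord α 1 (val u) = der u :=
  Dord_eq (hasDord_one.2 (hasD_energySpace u))

lemma Y_val (p : Pairs n) (u : energySpace α n a) : Y p.1.1 p.1.2 (val u) = ang p u :=
  Y_eq (hasY_energySpace p u)

lemma hasY_Y_val (u : energySpace α n a) (i j : Fin (n - 1)) :
    HasY i j (val u) (Y i j (val u)) := by
  obtain ⟨g, hg, -⟩ := exists_hasY (P := fun _ => True) trivial (fun _ _ => trivial)
    (fun p => ⟨ang p u, hasY_energySpace p u, trivial⟩) i j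
  exact hg.hasY_Y

lemma norm_energySpace_sq (u : energySpace α n a) :
    ‖u‖ ^ 2 = ‖val u‖ ^ 2 + (‖der u‖ ^ 2 + ∑ p, ‖ang p u‖ ^ 2) := by
  rw [← real_inner_self_eq_norm_sq, inner_energySpace]
  simp only [real_inner_self_eq_norm_sq]

lemma angNorm_one_val (u : energySpace α n a) :
    angNorm 1 (val u) = √(∑ p, ‖ang p u‖ ^ 2) := by
  simp only [angNorm, angNormSq, Y_val]

lemma h1Norm_val_le (u : energySpace α n a) : h1Norm α (val u) ≤ 3 * ‖u‖ := by
  have h := norm_energySpace_sq u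
  have hs : 0 ≤ ∑ p, ‖ang p u‖ ^ 2 := by positivity
  have h1 : ‖val u‖ ≤ ‖u‖ := by
    refine le_of_sq_le_sq ?_ (norm_nonneg _)
    nlinarith [sq_nonneg ‖der u‖]
  have h2 : ‖der u‖ ≤ ‖u‖ := by
    refine le_of_sq_le_sq ?_ (norm_nonneg _)
    nlinarith [sq_nonneg ‖val u‖]
  have h3 : √(∑ p, ‖ang p u‖ ^ 2) ≤ ‖u‖ := by
    refine Real.sqrt_le_iff.2 ⟨norm_nonneg _, ?_⟩
    nlinarith [sq_nonneg ‖val u‖, sq_nonneg ‖der u‖]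
  rw [h1Norm, Dord_val, angNorm_one_val]
  linarith

lemma memH10_val (u : energySpace α n a) : MemH10 α (val u) := by
  refine ⟨⟨trivial, fun i j => ⟨_, hasY_Y_val u i j, trivial⟩, der u,
    hasDord_one.2 (hasD_energySpace u)⟩, fun ε hε => ?_⟩
  obtain ⟨φ, hφ⟩ := denseRange_ofTest.exists_dist_lt u (ε := ε / 3) (by positivity)
  refine ⟨φ.1, φ.2, toL2 φ, coeFn_toL2 φ, ?_⟩
  rw [dist_eq_norm] at hφ
  have := h1Norm_val_le (u - ofTest α φ)
  rw [map_sub, val_ofTest] at this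
  linarith

/-- The weak derivatives of `v` form a jet. The approximating test functions converge to it because
the Hilbert norm of a jet is at most the sum of norms in `h1Norm`. -/
lemma exists_val_eq {v : L2 n a} (hv : MemH10 α v) : ∃ u : energySpace α n a, val u = v := by
  obtain ⟨⟨-, hY, g, hg⟩, hε⟩ := hv
  have hg' := hasDord_one.1 hg
  let x : Jet n a := WithLp.toLp 2 fun o => match o with
    | none => v
    | some none => Dord α 1 v
    | some (some p) => Y p.1.1 p.1.2 v
  suffices hx : x ∈ energySpace α n a from ⟨⟨x, hx⟩, rfl⟩
  refine Metric.mem_closure_iff.2 fun ε hpos => ?_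
  obtain ⟨φ, hφ, u, hu, hlt⟩ := hε ε hpos
  obtain rfl : u = toL2 ⟨φ, hφ⟩ := Lp.ext (hu.trans (coeFn_toL2 ⟨φ, hφ⟩).symm)
  set Φ : testSpace n a := ⟨φ, hφ⟩
  refine ⟨jet α Φ, ⟨Φ, rfl⟩, lt_of_le_of_lt ?_ hlt⟩
  have hD : Dord α 1 (v - toL2 Φ) = Dord α 1 v - toL2 (opD α Φ) := by
    rw [sub_eq_add_neg, sub_eq_add_neg, ← map_neg, ← map_neg, ← map_neg (opD α)]
    exact Dord_eq (hg.hasDord_Dord.add (hasDord_one.2 (hasD_energySpace (ofTest α (-Φ)))))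
  have hYY : ∀ p : Pairs n, Y p.1.1 p.1.2 (v - toL2 Φ) =
      Y p.1.1 p.1.2 v - toL2 (opY p.1.1 p.1.2 Φ) := fun p => by
    obtain ⟨f, hf, -⟩ := hY p.1.1 p.1.2
    rw [sub_eq_add_neg, sub_eq_add_neg, ← map_neg, ← map_neg, ← map_neg (opY p.1.1 p.1.2)]
    exact Y_eq (hf.hasY_Y.add (hasY_energySpace p (ofTest α (-Φ))))
  have hn : ‖x - jet α Φ‖ ^ 2 = ‖v - toL2 Φ‖ ^ 2 + (‖Dord α 1 (v - toL2 Φ)‖ ^ 2 +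
      ∑ p : Pairs n, ‖Y p.1.1 p.1.2 (v - toL2 Φ)‖ ^ 2) := by
    rw [PiLp.norm_sq_eq_of_L2, Fintype.sum_option, Fintype.sum_option, hD]
    simp only [hYY]
    rfl
  rw [dist_eq_norm]
  have h1 : h1Norm α (v - toL2 Φ) = ‖v - toL2 Φ‖ + ‖Dord α 1 (v - toL2 Φ)‖ +
      √(∑ p : Pairs n, ‖Y p.1.1 p.1.2 (v - toL2 Φ)‖ ^ 2) := rfl
  have hs := Real.sq_sqrt (show 0 ≤ ∑ p : Pairs n, ‖Y p.1.1 p.1.2 (v - toL2 Φ)‖ ^ 2 by positivity)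
  rw [← hs] at hn
  rw [h1]
  refine le_of_sq_le_sq ?_ (by positivity)
  rw [hn]
  have e1 := norm_nonneg (v - toL2 Φ)
  have e2 := norm_nonneg (Dord α 1 (v - toL2 Φ))
  have e3 := Real.sqrt_nonneg (∑ p : Pairs n, ‖Y p.1.1 p.1.2 (v - toL2 Φ)‖ ^ 2)
  nlinarith [mul_nonneg e1 e2, mul_nonneg e1 e3, mul_nonneg e2 e3]

lemma integral_energy (u v : energySpace α n a) :
    ∫ p, (Dord α 1 (val u) p * Dord α 1 (val v) p
      + inner ℝ (angGrad (val u) p) (angGrad (val v) p)) ∂(wMeasure n a) = form α n a u v := by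
  have h : ∀ᵐ x ∂(wMeasure n a), Dord α 1 (val u) x * Dord α 1 (val v) x
      + inner ℝ (angGrad (val u) x) (angGrad (val v) x) =
      der u x * der v x + ∑ p : Pairs n, ang p u x * ang p v x := by
    filter_upwards [inner_angGrad (hasY_Y_val u) (hasY_Y_val v)] with x hx
    rw [hx]
    simp only [Dord_val, Y_val]
  rw [integral_congr_ae h, integral_add (integrable_L2_mul _ _)
    (integrable_finsetSum _ fun p _ => integrable_L2_mul _ _),
    integral_finsetSum _ fun p _ => integrable_L2_mul _ _, form_apply]
  simp only [inner_L2]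

lemma IsWeakSolution.eq_val_sol (hα : 0 < α) (ha : 0 < a) {w F : L2 n a}
    (h : IsWeakSolution α w F) : w = val (sol hα ha F) := by
  obtain ⟨u, rfl⟩ := exists_val_eq h.1
  congr 1
  refine eq_of_form_eq hα ha fun φ => ?_
  rw [← integral_energy, h.2 _ (memH10_val _), form_sol, inner_L2]

end Solution

/-! ### Regularity of solutions -/

section Regularity

variable {n : ℕ} {a α : ℝ}

lemma HasD.smul {v g : L2 n a} (c : ℝ) (h : HasD α v g) : HasD α (c • v) (c • g) := by
  rw [hasD_iff] at *
  intro φ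
  rw [inner_smul_left, inner_smul_left, h]

lemma HasDstar.smul {v g : L2 n a} (c : ℝ) (h : HasDstar α v g) :
    HasDstar α (c • v) (c • g) := by
  rw [hasDstar_iff] at *
  intro φ
  rw [inner_smul_left, inner_smul_left, h]

lemma HasDord.smul {k : ℕ} {v g : L2 n a} (c : ℝ) (h : HasDord α k v g) :
    HasDord α k (c • v) (c • g) := by
  induction k generalizing g with
  | zero => exact congrArg (c • ·) h
  | succ k ih =>
    obtain ⟨f, hf, hg⟩ := h
    refine ⟨c • f, ih hf, ?_⟩
    split_ifs at hg ⊢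
    · exact hg.smul c
    · exact hg.smul c

lemma MemH.smul {k : ℕ} {v : L2 n a} (c : ℝ) (h : MemH α k v) : MemH α k (c • v) := by
  induction k generalizing v with
  | zero => trivial
  | succ k ih =>
    obtain ⟨h1, h2, g, hg⟩ := h
    refine ⟨ih h1, fun i j => ?_, c • g, hg.smul c⟩
    obtain ⟨f, hf, hf'⟩ := h2 i j
    exact ⟨c • f, hf.smul c, ih hf'⟩

lemma memH_zero (k : ℕ) : MemH α k (0 : L2 n a) := by
  induction k with
  | zero => trivial
  | succ k ih =>
    refine ⟨ih, fun i j => ⟨0, ?_, ih⟩, 0, hasDord_zero _⟩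
    simp [hasY_iff]

lemma MemH.neg {k : ℕ} {v : L2 n a} (h : MemH α k v) : MemH α k (-v) := by
  rw [← neg_one_smul ℝ v]
  exact h.smul _

lemma MemH.exists_hasY_memH {k : ℕ} {v : L2 n a} (h : MemH α (k + 1) v) (i j : Fin (n - 1)) :
    HasY i j v (Y i j v) ∧ MemH α k (Y i j v) := by
  obtain ⟨g, hg, hk⟩ := h.2.1 i j
  rw [Y_eq hg]
  exact ⟨hg, hk⟩

lemma MemH.hasDord_Dord {k : ℕ} {v : L2 n a} (h : MemH α k v) {j : ℕ} (hj : j ≤ k) :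
    HasDord α j v (Dord α j v) := by
  induction k with
  | zero =>
    obtain rfl : j = 0 := by omega
    exact HasDord.hasDord_Dord (g := v) rfl
  | succ k ih =>
    rcases hj.lt_or_eq with hj | rfl
    · exact ih h.1 (by omega)
    · obtain ⟨g, hg⟩ := h.2.2
      exact hg.hasDord_Dord

lemma MemH.hasY_Dord {k : ℕ} {v : L2 n a} (h : MemH α (k + 1) v) {j : ℕ} (hj : j ≤ k)
    (i i' : Fin (n - 1)) : HasY i i' (Dord α j v) (Dord α j (Y i i' v)) :=
  (h.exists_hasY_memH i i').1.of_hasDord (h.hasDord_Dord (by omega))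
    ((h.exists_hasY_memH i i').2.hasDord_Dord hj)

lemma ang_solY (hα : 0 < α) (ha : 0 < a) (p : Pairs n) (F : L2 n a) :
    ang p (solY hα ha p F) = Y p.1.1 p.1.2 (Y p.1.1 p.1.2 (val (sol hα ha F))) := by
  rw [Y_val, ← val_solY, Y_val]

/-- Induction on `m`: the angular derivatives solve the same equation with data `Y_p F`, one order
less regular. The equation then supplies the last radial derivative, as `F` and the second angular
derivatives of the solution have radial derivatives of order `m`. -/
lemma memH_sol (hα : 0 < α) (ha : 0 < a) {m : ℕ} {F : L2 n a} (hF : MemH α m F) :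
    MemH α (m + 2) (val (sol hα ha F)) := by
  induction m generalizing F with
  | zero =>
    refine ⟨(memH10_val _).1, exists_hasY (memH_zero _) (fun _ h => h.neg) fun p =>
      ⟨_, hasY_sol hα ha p F, (memH10_val _).1⟩, _,
      HasDord.comp_two (k := 0) (hasD_energySpace _) (hasDstar_der_sol hα ha F) rfl⟩
  | succ m ih =>
    have hY : ∀ p : Pairs n, MemH α (m + 2) (val (solY hα ha p F)) := fun p => by
      obtain ⟨h1, h2⟩ := hF.exists_hasY_memH p.1.1 p.1.2
      rw [solY_eq_sol hα ha p h1]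
      exact ih h2
    refine ⟨ih hF.1, exists_hasY (memH_zero _) (fun _ h => h.neg) fun p =>
      ⟨_, hasY_sol hα ha p F, hY p⟩, _,
      HasDord.comp_two (k := m + 1) (hasD_energySpace _) (hasDstar_der_sol hα ha F)
        ((hF.hasDord_Dord le_rfl).add (HasDord.sum _ (f' := fun p => Dord α (m + 1) (ang p (solY hα ha p F)))
          fun p => ?_))⟩
    · have := ((hY p).exists_hasY_memH p.1.1 p.1.2).2
      rw [Y_val] at this
      exact this.hasDord_Dord le_rfl

/-- The ordered radial derivatives of a solution, from the equation. -/
lemma Dord_sol (hα : 0 < α) (ha : 0 < a) {m j : ℕ} {F : L2 n a} (hF : MemH α m F) (hj : j ≤ m) :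
    Dord α (j + 2) (val (sol hα ha F)) = Dord α j F + ∑ p : Pairs n,
      Y p.1.1 p.1.2 (Y p.1.1 p.1.2 (Dord α j (val (sol hα ha F)))) := by
  have hw := memH_sol hα ha hF
  refine Dord_eq (HasDord.comp_two (hasD_energySpace _) (hasDstar_der_sol hα ha F)
    ((hF.hasDord_Dord hj).add (HasDord.sum _ fun p => ?_)))
  have h1 := (hw.exists_hasY_memH p.1.1 p.1.2).2
  have h2 := (h1.exists_hasY_memH p.1.1 p.1.2).2
  rw [Y_eq (hw.hasY_Dord (by omega) p.1.1 p.1.2), Y_eq (h1.hasY_Dord hj p.1.1 p.1.2), ang_solY]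
  exact h2.hasDord_Dord hj

end Regularity

/-! ### Angular norms -/

section AngularNorm

variable {n : ℕ} {a α : ℝ}

/-- All angular derivatives of order at most `l` exist in `L²`. -/
def MemAng : ℕ → L2 n a → Prop
  | 0, _ => True
  | l + 1, v => ∀ p : Pairs n, HasY p.1.1 p.1.2 v (Y p.1.1 p.1.2 v) ∧
      MemAng l (Y p.1.1 p.1.2 v)

lemma MemH.memAng_Dord {k j l : ℕ} {v : L2 n a} (h : MemH α k v) (hk : l + j ≤ k) :
    MemAng l (Dord α j v) := by
  induction l generalizing k v with
  | zero => trivial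
  | succ l ih =>
    obtain ⟨k, rfl⟩ : ∃ k', k = k' + 1 := ⟨k - 1, by omega⟩
    intro p
    have h1 := h.hasY_Dord (j := j) (by omega) p.1.1 p.1.2
    rw [Y_eq h1]
    exact ⟨h1, ih (h.exists_hasY_memH _ _).2 (by omega)⟩

lemma Dord_zero (v : L2 n a) : Dord α 0 v = v := Dord_eq rfl

lemma MemH.memAng {k l : ℕ} {v : L2 n a} (h : MemH α k v) (hk : l ≤ k) : MemAng l v := by
  rw [← Dord_zero (α := α) v]
  exact h.memAng_Dord hk

lemma angNormSq_nonneg (l : ℕ) (v : L2 n a) : 0 ≤ angNormSq l v := by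
  induction l generalizing v with
  | zero => exact sq_nonneg _
  | succ l ih => exact Finset.sum_nonneg fun p _ => ih _

lemma angNorm_nonneg (l : ℕ) (v : L2 n a) : 0 ≤ angNorm l v := Real.sqrt_nonneg _

lemma angNorm_sq (l : ℕ) (v : L2 n a) : angNorm l v ^ 2 = angNormSq l v :=
  Real.sq_sqrt (angNormSq_nonneg l v)

lemma angNorm_zero (v : L2 n a) : angNorm 0 v = ‖v‖ := by
  rw [angNorm, angNormSq, Real.sqrt_sq (norm_nonneg _)]

lemma angNormSq_smul {l : ℕ} {v : L2 n a} (c : ℝ) (h : MemAng l v) :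
    angNormSq l (c • v) = c ^ 2 * angNormSq l v := by
  induction l generalizing v with
  | zero => simp [angNormSq, norm_smul, mul_pow]
  | succ l ih =>
    simp only [angNormSq, Finset.mul_sum]
    refine Finset.sum_congr rfl fun p _ => ?_
    rw [Y_eq ((h p).1.smul c), ih (h p).2]

lemma angNorm_smul {l : ℕ} {v : L2 n a} {c : ℝ} (hc : 0 ≤ c) (h : MemAng l v) :
    angNorm l (c • v) = c * angNorm l v := by
  rw [angNorm, angNormSq_smul c h, Real.sqrt_mul (sq_nonneg c), Real.sqrt_sq hc, angNorm]

/-- `MemAng` guards against the default value zero of `Y`, which need not be additive where weak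
derivatives are missing. -/
lemma angNormSq_add_le {l : ℕ} {u v : L2 n a} (hu : MemAng l u) (hv : MemAng l v) :
    angNormSq l (u + v) ≤ 2 * (angNormSq l u + angNormSq l v) := by
  induction l generalizing u v with
  | zero =>
    have h1 := norm_add_le u v
    have h2 : ‖u + v‖ ^ 2 ≤ (‖u‖ + ‖v‖) ^ 2 := by gcongr
    simp only [angNormSq]
    nlinarith [sq_nonneg (‖u‖ - ‖v‖)]
  | succ l ih =>
    simp only [angNormSq, ← Finset.sum_add_distrib, Finset.mul_sum]
    refine Finset.sum_le_sum fun p _ => ?_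
    rw [Y_eq ((hu p).1.add (hv p).1), mul_add]
    simpa only [mul_add] using ih (hu p).2 (hv p).2

lemma hasY_sum {ι : Type*} (s : Finset ι) {i j : Fin (n - 1)} {f f' : ι → L2 n a}
    (h : ∀ x, HasY i j (f x) (f' x)) : HasY i j (∑ x ∈ s, f x) (∑ x ∈ s, f' x) := by
  rw [hasY_iff]
  intro φ
  rw [sum_inner, sum_inner, ← Finset.sum_neg_distrib]
  exact Finset.sum_congr rfl fun x _ => hasY_iff.1 (h x) φ

lemma MemAng.sum {ι : Type*} (s : Finset ι) {l : ℕ} {f : ι → L2 n a} (h : ∀ x, MemAng l (f x)) :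
    MemAng l (∑ x ∈ s, f x) := by
  induction l generalizing f with
  | zero => trivial
  | succ l ih =>
    intro p
    have := hasY_sum s fun x => (h x p).1
    rw [Y_eq this]
    exact ⟨this, ih fun x => (h x p).2⟩

lemma angNormSq_sum_le {ι : Type*} (s : Finset ι) {l : ℕ} {f : ι → L2 n a}
    (h : ∀ x, MemAng l (f x)) :
    angNormSq l (∑ x ∈ s, f x) ≤ s.card * ∑ x ∈ s, angNormSq l (f x) := by
  induction l generalizing f with
  | zero =>
    have h1 : ‖∑ x ∈ s, f x‖ ^ 2 ≤ (∑ x ∈ s, ‖f x‖) ^ 2 := by gcongr; exact norm_sum_le _ _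
    exact h1.trans sq_sum_le_card_mul_sum_sq
  | succ l ih =>
    simp only [angNormSq]
    rw [Finset.sum_comm, Finset.mul_sum]
    refine Finset.sum_le_sum fun p _ => ?_
    rw [Y_eq (hasY_sum s fun x => (h x p).1)]
    exact ih fun x => (h x p).2

/-- The angular Laplacian is controlled by the angular derivatives of second order. -/
lemma angNorm_add_laplacian_le {l : ℕ} {f g : L2 n a} (hf : MemAng l f) (hg : MemAng (l + 2) g) :
    angNorm l (f + ∑ p : Pairs n, Y p.1.1 p.1.2 (Y p.1.1 p.1.2 g)) ≤
      2 * angNorm l f + 2 * (Fintype.card (Pairs n) + 1) * angNorm (l + 2) g := by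
  have hp : ∀ p : Pairs n, MemAng l (Y p.1.1 p.1.2 (Y p.1.1 p.1.2 g)) := fun p =>
    ((hg p).2 p).2
  have h1 := angNormSq_add_le hf (MemAng.sum Finset.univ hp)
  have h2 := angNormSq_sum_le Finset.univ hp
  have h3 : ∑ p : Pairs n, angNormSq l (Y p.1.1 p.1.2 (Y p.1.1 p.1.2 g)) ≤
      angNormSq (l + 2) g :=
    Finset.sum_le_sum fun p _ => Finset.single_le_sum
      (f := fun q : Pairs n => angNormSq l (Y q.1.1 q.1.2 (Y p.1.1 p.1.2 g)))
      (fun q _ => angNormSq_nonneg _ _) (Finset.mem_univ p)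
  have hN : (0 : ℝ) ≤ Fintype.card (Pairs n) := Nat.cast_nonneg _
  rw [Finset.card_univ] at h2
  have h4 := mul_le_mul_of_nonneg_left h3 hN
  have hF := angNorm_nonneg l f
  have hG := angNorm_nonneg (l + 2) g
  refine Real.sqrt_le_iff.2 ⟨by positivity, ?_⟩
  have h5 : angNormSq l (f + ∑ p : Pairs n, Y p.1.1 p.1.2 (Y p.1.1 p.1.2 g)) ≤
      2 * (angNorm l f ^ 2 + Fintype.card (Pairs n) * angNorm (l + 2) g ^ 2) := by
    rw [angNorm_sq, angNorm_sq]
    linarith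
  refine h5.trans ?_
  generalize (Fintype.card (Pairs n) : ℝ) = N at hN
  generalize angNorm l f = x at hF
  generalize angNorm (l + 2) g = y at hG
  nlinarith [mul_nonneg hF hG, mul_nonneg hN (mul_nonneg hF hG), mul_nonneg hN (sq_nonneg y),
    mul_nonneg (mul_nonneg hN hN) (sq_nonneg y), sq_nonneg x, sq_nonneg y]

/-- An `L²` estimate for an operator that commutes with the angular derivatives holds for the
angular derivatives of all orders. -/
lemma angNormSq_le_of_commute {r : ℕ} {K : ℝ} {T : L2 n a → L2 n a}
    (hT : ∀ (p : Pairs n) F F', HasY p.1.1 p.1.2 F F' → HasY p.1.1 p.1.2 (T F) (T F'))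
    (h0 : ∀ F, angNormSq r (T F) ≤ K * ‖F‖ ^ 2) {l : ℕ} {F : L2 n a} (hF : MemAng l F) :
    angNormSq (l + r) (T F) ≤ K * angNormSq l F := by
  induction l generalizing F with
  | zero => rw [zero_add]; exact h0 F
  | succ l ih =>
    -- `angNormSq` splits off the derivative that is applied first, and this one can be passed
    -- through `T` to `F`.
    rw [Nat.add_right_comm]
    simp only [angNormSq, Finset.mul_sum]
    refine Finset.sum_le_sum fun p _ => ?_
    rw [Y_eq (hT p F _ (hF p).1)]
    exact ih (hF p).2

lemma angNorm_le_of_commute {r : ℕ} {K : ℝ} (hK : 0 ≤ K) {T : L2 n a → L2 n a}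
    (hT : ∀ (p : Pairs n) F F', HasY p.1.1 p.1.2 F F' → HasY p.1.1 p.1.2 (T F) (T F'))
    (h0 : ∀ F, angNormSq r (T F) ≤ K ^ 2 * ‖F‖ ^ 2) {l : ℕ} {F : L2 n a} (hF : MemAng l F) :
    angNorm (l + r) (T F) ≤ K * angNorm l F := by
  refine Real.sqrt_le_iff.2 ⟨mul_nonneg hK (angNorm_nonneg _ _), ?_⟩
  rw [mul_pow, angNorm_sq]
  exact angNormSq_le_of_commute hT h0 hF

end AngularNorm

/-! ### Estimates for solutions -/

section Estimates

variable {n : ℕ} {a α : ℝ}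

lemma hasY_val_sol (hα : 0 < α) (ha : 0 < a) (p : Pairs n) (F F' : L2 n a)
    (h : HasY p.1.1 p.1.2 F F') :
    HasY p.1.1 p.1.2 (val (sol hα ha F)) (val (sol hα ha F')) := by
  rw [← solY_eq_sol hα ha p h]
  exact hasY_sol hα ha p F

lemma hasY_der_solY (hα : 0 < α) (ha : 0 < a) (p : Pairs n) (F : L2 n a) :
    HasY p.1.1 p.1.2 (der (sol hα ha F)) (der (solY hα ha p F)) :=
  (hasY_sol hα ha p F).of_hasD (hasD_energySpace _) (hasD_energySpace _)

lemma hasY_der_sol (hα : 0 < α) (ha : 0 < a) (p : Pairs n) (F F' : L2 n a)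
    (h : HasY p.1.1 p.1.2 F F') :
    HasY p.1.1 p.1.2 (der (sol hα ha F)) (der (sol hα ha F')) :=
  (hasY_val_sol hα ha p F F' h).of_hasD (hasD_energySpace _) (hasD_energySpace _)

lemma angNorm_succ_val_sol_le (hα : 0 < α) (ha : 0 < a) {l : ℕ} {F : L2 n a} (hF : MemAng l F) :
    angNorm (l + 1) (val (sol hα ha F)) ≤ a / α * angNorm l F := by
  refine angNorm_le_of_commute (T := fun F => val (sol hα ha F)) (by positivity)
    (hasY_val_sol hα ha) (fun F => ?_) hF
  simp only [angNormSq, Y_val]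
  exact (sum_norm_ang_sq_le _).trans (form_sol_self_le hα ha F)

/-- The energy of each `Y_p S F` is at most `‖F‖²`, and there are as many of them as rotation
fields; hence the square root and no power of `a`. -/
lemma angNorm_add_two_val_sol_le (hα : 0 < α) (ha : 0 < a) {l : ℕ} {F : L2 n a}
    (hF : MemAng l F) :
    angNorm (l + 2) (val (sol hα ha F)) ≤ √(Fintype.card (Pairs n)) * angNorm l F := by
  refine angNorm_le_of_commute (T := fun F => val (sol hα ha F)) (by positivity)
    (hasY_val_sol hα ha) (fun F => ?_) hF
  rw [Real.sq_sqrt (Nat.cast_nonneg _), ← nsmul_eq_mul, ← Finset.card_univ]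
  refine Finset.sum_le_card_nsmul _ _ _ fun p _ => ?_
  rw [Y_val, ← val_solY]
  simp only [angNormSq, Y_val]
  exact (sum_norm_ang_sq_le _).trans (form_solY_self_le hα ha p F)

lemma angNorm_der_sol_le (hα : 0 < α) (ha : 0 < a) {l : ℕ} {F : L2 n a} (hF : MemAng l F) :
    angNorm l (der (sol hα ha F)) ≤ a / α * angNorm l F := by
  refine angNorm_le_of_commute (r := 0) (T := fun F => der (sol hα ha F)) (by positivity)
    (hasY_der_sol hα ha) (fun F => ?_) hF
  rw [← mul_pow]
  exact pow_le_pow_left₀ (norm_nonneg _) (norm_der_sol_le hα ha F) 2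

lemma angNorm_succ_der_sol_le (hα : 0 < α) (ha : 0 < a) {l : ℕ} {F : L2 n a}
    (hF : MemAng l F) :
    angNorm (l + 1) (der (sol hα ha F)) ≤ √(Fintype.card (Pairs n)) * angNorm l F := by
  refine angNorm_le_of_commute (T := fun F => der (sol hα ha F)) (by positivity)
    (hasY_der_sol hα ha) (fun F => ?_) hF
  rw [Real.sq_sqrt (Nat.cast_nonneg _), ← nsmul_eq_mul, ← Finset.card_univ]
  refine Finset.sum_le_card_nsmul _ _ _ fun p _ => ?_
  rw [Y_eq (hasY_der_solY hα ha p F)]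
  exact (norm_der_sq_le _).trans (form_solY_self_le hα ha p F)

lemma angNorm_le_hNorm {m l : ℕ} (F : L2 n a) (hl : l ≤ m) : angNorm l F ≤ hNorm α 1 m F := by
  obtain _ | m := m
  · obtain rfl : l = 0 := by omega
    rw [angNorm_zero]
    exact le_rfl
  have h1 : 0 ≤ ∑ l ∈ Finset.range m, angNorm l (DordXi α (m + 1 - l) F) / 1 ^ 2 :=
    Finset.sum_nonneg fun l _ => div_nonneg (angNorm_nonneg _ _) (by norm_num)
  have h2 : ∀ l, 0 ≤ angNorm l F + angNorm (l - 1) (DordXi α 1 F) / 1 := fun l =>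
    add_nonneg (angNorm_nonneg _ _) (div_nonneg (angNorm_nonneg _ _) (by norm_num))
  simp only [hNorm]
  obtain _ | l := l
  · have h3 := Finset.sum_nonneg fun l (_ : l ∈ Finset.Icc 1 (m + 1)) => h2 l
    rw [angNorm_zero]
    linarith
  · have h3 := Finset.single_le_sum (fun l _ => h2 l)
      (show l + 1 ∈ Finset.Icc 1 (m + 1) by simp; omega)
    have h4 : 0 ≤ angNorm (l + 1 - 1) (DordXi α 1 F) / 1 :=
      div_nonneg (angNorm_nonneg _ _) (by norm_num)
    linarith [norm_nonneg F]

/-- The terms of top order sit in different places of the norm: those with at most one radial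
derivative in the middle sum (for `m ≥ 1`), the others in the last sum. -/
lemma angNorm_DordXi_le_hNorm {m l j : ℕ} (F : L2 n a) (hlj : l + j = m) :
    angNorm l (DordXi α j F) ≤ hNorm α 1 m F := by
  rcases j with _ | _ | j
  · rw [DordXi, Dord_zero, pow_zero, one_smul]
    exact angNorm_le_hNorm F (by omega)
  · obtain rfl := hlj
    have h1 : 0 ≤ ∑ k ∈ Finset.range l, angNorm k (DordXi α (l + 1 - k) F) / 1 ^ 2 :=
      Finset.sum_nonneg fun l _ => div_nonneg (angNorm_nonneg _ _) (by norm_num)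
    have h2 : ∀ l, 0 ≤ angNorm l F + angNorm (l - 1) (DordXi α 1 F) / 1 := fun l =>
      add_nonneg (angNorm_nonneg _ _) (div_nonneg (angNorm_nonneg _ _) (by norm_num))
    have h3 := Finset.single_le_sum (fun l _ => h2 l)
      (show l + 1 ∈ Finset.Icc 1 (l + 1) by simp)
    simp only [zero_add, hNorm]
    rw [Nat.add_sub_cancel] at h3
    linarith [norm_nonneg F, angNorm_nonneg (l + 1) F]
  · obtain ⟨k, rfl⟩ : ∃ k, m = k + 1 := ⟨m - 1, by omega⟩
    have h2 : 0 ≤ ∑ l ∈ Finset.Icc 1 (k + 1),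
        (angNorm l F + angNorm (l - 1) (DordXi α 1 F) / 1) :=
      Finset.sum_nonneg fun l _ =>
        add_nonneg (angNorm_nonneg _ _) (div_nonneg (angNorm_nonneg _ _) (by norm_num))
    have h3 := Finset.single_le_sum
      (f := fun l => angNorm l (DordXi α (k + 1 - l) F) / 1 ^ 2)
      (fun l _ => div_nonneg (angNorm_nonneg _ _) (by norm_num))
      (show l ∈ Finset.range k by simp; omega)
    have h4 : k + 1 - l = j + 1 + 1 := by omega
    simp only [h4] at h3
    simp only [hNorm]
    linarith [norm_nonneg F]

lemma hNorm_nonneg (m : ℕ) (F : L2 n a) : 0 ≤ hNorm α 1 m F :=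
  (angNorm_nonneg 0 F).trans (angNorm_le_hNorm F (Nat.zero_le m))

lemma angNorm_DordXi {l j k : ℕ} {v : L2 n a} (ha : 0 < a) (h : MemH α k v) (hk : l + j ≤ k) :
    angNorm l (DordXi α j v) = a ^ j * angNorm l (Dord α j v) :=
  angNorm_smul (by positivity) (h.memAng_Dord hk)

/-- The equation is multiplied by `a ^ (j + 2)`, of which `a ^ j` turns `D_x` into `D_ξ`. The
remaining `a ^ 2` is kept explicit, since it cancels the weight of the last sum. -/
lemma angNorm_DordXi_add_two_sol_le (hα : 0 < α) (ha : 0 < a) {m j l : ℕ} {F : L2 n a}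
    (hF : MemH α m F) (hlj : l + j = m) {D : ℝ}
    (hD : angNorm (l + 2) (DordXi α j (val (sol hα ha F))) ≤ D * hNorm α 1 m F) :
    angNorm l (DordXi α (j + 2) (val (sol hα ha F))) ≤
      a ^ 2 * ((2 + 2 * (Fintype.card (Pairs n) + 1) * D) * hNorm α 1 m F) := by
  have hw := memH_sol hα ha hF
  have h1 := angNorm_DordXi_le_hNorm (α := α) F hlj
  rw [angNorm_DordXi ha hw (by omega)] at hD
  rw [angNorm_DordXi ha hF (by omega)] at h1
  rw [angNorm_DordXi ha hw (by omega), Dord_sol hα ha hF (by omega)]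
  have h2 := angNorm_add_laplacian_le (hF.memAng_Dord (l := l) (j := j) (by omega))
    (hw.memAng_Dord (l := l + 2) (j := j) (by omega))
  set x := angNorm l (Dord α j F)
  set y := angNorm (l + 2) (Dord α j (val (sol hα ha F)))
  set h := hNorm α 1 m F
  calc _ ≤ a ^ (j + 2) * (2 * x + 2 * (Fintype.card (Pairs n) + 1) * y) := by gcongr
    _ = a ^ 2 * (2 * (a ^ j * x) + 2 * (Fintype.card (Pairs n) + 1) * (a ^ j * y)) := by ring
    _ ≤ a ^ 2 * (2 * h + 2 * (Fintype.card (Pairs n) + 1) * (D * h)) := by gcongr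
    _ = _ := by ring

/-- Induction on `j` in steps of two at fixed total order `m + 2`: the equation trades two radial
derivatives for two angular ones until `j` is `0` or `1`, where the energy estimates apply. The
factors of `a` are bounded by `a₀`, so `D` does not depend on `a`. -/
lemma exists_angNorm_DordXi_sol_le (n : ℕ) (hα : 0 < α) (m : ℕ) {a₀ : ℝ} (ha₀ : 0 < a₀)
    (j : ℕ) : ∃ D : ℝ, 0 ≤ D ∧ ∀ (a : ℝ) (ha : 0 < a), a ≤ a₀ → ∀ F : L2 n a, MemH α m F →
      ∀ l, l + j = m →
        angNorm (l + 2) (DordXi α j (val (sol hα ha F))) ≤ D * hNorm α 1 m F := by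
  induction j using Nat.twoStepInduction with
  | zero =>
    refine ⟨√(Fintype.card (Pairs n)), by positivity, fun a ha _ F hF l hl => ?_⟩
    rw [DordXi, Dord_zero, pow_zero, one_smul]
    refine (angNorm_add_two_val_sol_le hα ha (hF.memAng hl.le)).trans ?_
    gcongr
    exact angNorm_le_hNorm F hl.le
  | one =>
    refine ⟨a₀ * √(Fintype.card (Pairs n)), by positivity, fun a ha haa F hF l hl => ?_⟩
    rw [angNorm_DordXi ha (memH_sol hα ha hF) (by omega), Dord_val, pow_one, mul_assoc]
    have h1 := angNorm_succ_der_sol_le hα ha (hF.memAng hl.le)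
    have h2 := angNorm_le_hNorm (α := α) F hl.le
    have h3 := angNorm_nonneg (l + 2) (der (sol hα ha F))
    calc _ ≤ a₀ * (√(Fintype.card (Pairs n)) * angNorm (l + 1) F) := by gcongr
      _ ≤ _ := by gcongr
  | more j ih _ =>
    obtain ⟨D, hD, h⟩ := ih
    refine ⟨a₀ ^ 2 * (2 + 2 * (Fintype.card (Pairs n) + 1) * D), by positivity,
      fun a ha haa F hF l hl => ?_⟩
    have h1 := angNorm_DordXi_add_two_sol_le hα ha hF (l := l + 2) (j := j) (by omega)
      (h a ha haa F hF (l + 2) (by omega))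
    refine h1.trans ?_
    rw [mul_assoc (a₀ ^ 2)]
    have := hNorm_nonneg (α := α) m F
    gcongr

/-- The terms of the norm of a solution that involve at most one radial derivative. -/
lemma angNorm_val_add_der_sol_le (hα : 0 < α) (ha : 0 < a) {m l : ℕ} {a₀ : ℝ} (haa : a ≤ a₀)
    {F : L2 n a} (hF : MemH α m F) (hl : l ∈ Finset.Icc 1 (m + 2)) :
    angNorm l (val (sol hα ha F)) + angNorm (l - 1) (DordXi α 1 (val (sol hα ha F))) / a ≤
      2 * (a₀ / α + √(Fintype.card (Pairs n))) * hNorm α 1 m F := by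
  obtain ⟨hl1, hl2⟩ := Finset.mem_Icc.1 hl
  obtain ⟨k, rfl⟩ : ∃ k, l = k + 1 := ⟨l - 1, by omega⟩
  have hh := hNorm_nonneg (α := α) m F
  have hN := Real.sqrt_nonneg (Fintype.card (Pairs n))
  have hA : a / α ≤ a₀ / α := by gcongr
  have hA0 : 0 < a / α := by positivity
  rw [Nat.add_sub_cancel, angNorm_DordXi ha (memH_sol hα ha hF) (by omega), Dord_val, pow_one,
    mul_div_cancel_left₀ _ ha.ne']
  have key : ∀ {c x : ℝ}, 0 ≤ c → c ≤ a₀ / α + √(Fintype.card (Pairs n)) → x ≤ hNorm α 1 m F →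
      c * x ≤ (a₀ / α + √(Fintype.card (Pairs n))) * hNorm α 1 m F := fun {c x} h0 h1 h2 =>
    (mul_le_mul_of_nonneg_left h2 h0).trans (mul_le_mul_of_nonneg_right h1 hh)
  rw [two_mul, add_mul]
  -- For `k = m + 1` the datum `F` lacks the angular derivative of order `k`, so the estimates that
  -- gain one more derivative, without the factor `a / α`, are used.
  rcases (by omega : k ≤ m ∨ k = m + 1) with hk | rfl
  · have hX := angNorm_le_hNorm (α := α) F hk
    exact add_le_add
      ((angNorm_succ_val_sol_le hα ha (hF.memAng hk)).trans (key hA0.le (by linarith) hX))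
      ((angNorm_der_sol_le hα ha (hF.memAng hk)).trans (key hA0.le (by linarith) hX))
  · have hX := angNorm_le_hNorm (α := α) F (le_refl m)
    exact add_le_add
      ((angNorm_add_two_val_sol_le hα ha (hF.memAng le_rfl)).trans (key hN (by linarith) hX))
      ((angNorm_succ_der_sol_le hα ha (hF.memAng le_rfl)).trans (key hN (by linarith) hX))

/-- The terms of the norm of a solution that involve several radial derivatives. -/
lemma exists_angNorm_DordXi_add_two_sol_le (n : ℕ) (hα : 0 < α) (m : ℕ) {a₀ : ℝ} (ha₀ : 0 < a₀)
    (l : ℕ) (hl : l ≤ m) : ∃ D : ℝ, 0 ≤ D ∧ ∀ (a : ℝ) (ha : 0 < a), a ≤ a₀ → ∀ F : L2 n a,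
      MemH α m F →
        angNorm l (DordXi α (m + 2 - l) (val (sol hα ha F))) / a ^ 2 ≤ D * hNorm α 1 m F := by
  obtain ⟨D, hD, h⟩ := exists_angNorm_DordXi_sol_le n hα m ha₀ (m - l)
  refine ⟨2 + 2 * (Fintype.card (Pairs n) + 1) * D, by positivity, fun a ha haa F hF => ?_⟩
  rw [div_le_iff₀ (by positivity), mul_comm _ (a ^ 2), Nat.sub_add_comm hl]
  exact angNorm_DordXi_add_two_sol_le hα ha hF (by omega) (h a ha haa F hF l (by omega))

end Estimates

end TwistedSobolev

end

theorem theoremT (n : ℕ) (hn : 2 ≤ n) (α : ℝ) (hα : 0 < α) (m : ℕ) (a₀ : ℝ) (ha₀ : 0 < a₀) :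
    ∃ c : ℝ, 0 < c ∧ ∀ a : ℝ, 0 < a → a ≤ a₀ → ∀ w F : L2 n a,
      MemH α m F → IsWeakSolution α w F →
        MemH α (m + 2) w ∧ hNorm α a (m + 2) w ≤ c * hNorm α 1 m F := by
  -- The constants are extended by zero beyond `l = m`, so that a single function of `l` can be
  -- chosen before `a`.
  have hex : ∀ l : ℕ, ∃ D : ℝ, 0 ≤ D ∧ (l ≤ m → ∀ (a : ℝ) (ha : 0 < a), a ≤ a₀ →
      ∀ F : L2 n a, MemH α m F →
        angNorm l (DordXi α (m + 2 - l) (val (sol hα ha F))) / a ^ 2 ≤ D * hNorm α 1 m F) :=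
    fun l => by
      by_cases hl : l ≤ m
      · obtain ⟨D, hD, h⟩ := exists_angNorm_DordXi_add_two_sol_le n hα m ha₀ l hl
        exact ⟨D, hD, fun _ => h⟩
      · exact ⟨0, le_rfl, fun h => absurd h hl⟩
  choose D hD0 hD using hex
  -- The three summands bound the three parts of the norm: the function itself, the terms with at
  -- most one radial derivative, and the top-order terms with at least two.
  refine ⟨a₀ / α ^ 2 + ∑ _l ∈ Finset.Icc 1 (m + 2),
    2 * (a₀ / α + √(Fintype.card (Pairs n))) + ∑ l ∈ Finset.range (m + 1), D l, ?_,
    fun a ha haa w F hF hw => ?_⟩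
  · have h1 : 0 ≤ ∑ l ∈ Finset.range (m + 1), D l := Finset.sum_nonneg fun l _ => hD0 l
    positivity
  · obtain rfl := hw.eq_val_sol hα ha
    refine ⟨memH_sol hα ha hF, ?_⟩
    have h1 : ‖val (sol hα ha F)‖ / a ≤ a₀ / α ^ 2 * hNorm α 1 m F := by
      have hX := angNorm_le_hNorm (α := α) F (Nat.zero_le m)
      rw [angNorm_zero] at hX
      have h2 := norm_val_sol_le hα ha F
      rw [div_le_iff₀ ha]
      calc _ ≤ (a / α) ^ 2 * ‖F‖ := h2
        _ = a / α ^ 2 * ‖F‖ * a := by field_simp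
        _ ≤ _ := by gcongr
    rw [add_mul, add_mul, Finset.sum_mul, Finset.sum_mul]
    simp only [hNorm]
    refine add_le_add (add_le_add h1 (Finset.sum_le_sum fun l hl => ?_))
      (Finset.sum_le_sum fun l hl => ?_)
    · exact angNorm_val_add_der_sol_le hα ha haa hF hl
    · exact hD l (by simpa [Nat.lt_succ_iff] using hl) a ha haa F hF
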